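/- Let $\kappa$ be either an infinite regular cardinal or the symbol $\infty$, deemed greater than every cardinal and every ordinal. Let $\mathcal P_{<\kappa}$ be the functor on $\mathbf{Set}$ sending $X$ to the set of its subsets of cardinality $<\kappa$ (all subsets if $\kappa=\infty$) and a map $f$ to direct image under $f$. The ordinal $0$ counts as a limit ordinal. The final chain of $\mathcal P_{<\kappa}$ consists of sets $\nu_i$ ($i$ an ordinal) and connecting maps $\nu_{j,i}:\nu_i\to\nu_j$ ($j\le i$): $\nu_{i+1}=\mathcal P_{<\kappa}\nu_i$ and $\nu_{j+1,i+1}(a)=\{\nu_{j,i}(b)\mid b\in a\}$; for a limit $i$, $\nu_i$ is the set of families $(x_j)_{j<i}$ with $x_j\in\nu_j$ and $\nu_{k,j}(x_j)=x_k$ for $k\le j<i$, and $\nu_{j,i}$ is the $j$-th projection for $j<i$. For a limit $i$, $\nu_i$ is a transition system: $b$ is a successor of $a$, written $a\rightsquigarrow b$, when $b_j\in a_{j+1}$ for all $j<i$. A subset of a transition system is a subsystem when it contains every successor of each of its elements. Let $0(i)\in\nu_i$ be given by $0(i+1)=\emptyset$ and $0(i)=(0(j))_{j<i}$ for a limit $i$.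 For a coalgebra $\zeta:X\to\mathcal P_{<\kappa}X$ define $p_i:X\to\nu_i$ by $p_{i+1}(x)=\{p_i(y)\mid y\in\zeta(x)\}$ and $p_i(x)=(p_j(x))_{j<i}$ for a limit $i$. An element of $\nu_i$ is $\mathcal P_{<\kappa}$-coalgebraic when it equals $p_i(x)$ for some such coalgebra and some $x\in X$. For a limit $i$, a $\mathcal P_{<\kappa}$-ghost at $i$ is an element of $\nu_i$ that is different from $0(i)$, has no successor, and has all its components $\mathcal P_{<\kappa}$-coalgebraic. An ordinal is $\omega$-cofinal when it is the supremum of a strictly increasing sequence $(i_n)_{n\in\mathbb N}$ of ordinals. For an infinite regular cardinal $\lambda$, a tidy $\lambda$-tree is a functor $D:\lambda^{\mathrm{op}}\to\mathbf{Set}$ whose connecting maps are all surjective, such that $D_0\neq\emptyset$ and, for each limit $i<\lambda$ (including $0$), every compatible family $(x_j\in D_j)_{j<i}$ has at most one extension to a compatible family $(x_j)_{j\le i}$. The cardinal $\lambda$ is weakly compact when $|A|<\lambda$ implies $|\mathcal P A|<\lambda$ for every set $A$, and every tidy $\lambda$-tree with all levels of size $<\lambda$ has a full branch, that is, a compatible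 family $(x_i\in D_i)_{i<\lambda}$. (So $\aleph_0$ is weakly compact.) Cardinals are identified with initial ordinals. **Proposition.** For a limit ordinal $i$, the following are equivalent. 1. The $\mathcal P_{<\kappa}$-coalgebraic elements form a subsystem of $\nu_i$. 2. $i$ is either $0$, or $\omega$-cofinal, or weakly compact, or $\geqslant\kappa$ (with $\kappa<\infty$). Moreover, if condition 2 fails, then there is a $\mathcal P_{<\kappa}$-ghost at $i$, and every $\mathcal P_{<\kappa}$-ghost at $i$ fails to be $\mathcal P_{<\kappa}$-coalgebraic but is a successor of some $\mathcal P_{<\kappa}$-coalgebraic element of $\nu_i$. -/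

import Mathlib

universe u

noncomputable section

namespace FinalChain

open Order

/-! ### Restricted powersets

`κ : WithTop Cardinal.{u}` is a cardinal or the symbol `⊤` ("infinity"), which is greater than every
cardinal and every ordinal. "Sets" are types in `Type u`, ordinals are in `Ordinal.{u}`. -/

/-- `κ` is infinite and regular; the symbol `⊤` is deemed to be so. -/
def InfiniteRegular (κ : WithTop Cardinal.{u}) : Prop :=
  κ = ⊤ ∨ ∃ c : Cardinal.{u}, κ = c ∧ c.IsRegular

/-- The subset `s` is `<κ`-sized, i.e. belongs to the restricted powerset `P_{<κ} α`.
For `κ = ⊤` every subset is. -/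
def SizeLT (κ : WithTop Cardinal.{u}) {α : Type u} (s : Set α) : Prop :=
  (Cardinal.mk s : WithTop Cardinal.{u}) < κ

/-- `κ` is a cardinal (not `⊤`) and the ordinal `i` is at least `κ`. -/
def LEOrd (κ : WithTop Cardinal.{u}) (i : Ordinal.{u}) : Prop :=
  ∃ c : Cardinal.{u}, κ = c ∧ c.ord ≤ i

/-! ### The ambient types

`Pre i` is an ambient type in which the `i`-th level of the final chain is carved out as a subset:
`Pre (i + 1)` is the type of all subsets of `Pre i`, and for a limit `i` (`0` included, so that
`Order.IsSuccPrelimit` is the notion of limit throughout) `Pre i` is the type of all families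
`(x_j)_{j < i}` with `x_j : Pre j`, compatible or not. -/

/-- The ambient type at `i`. (`Shrink` only serves to stay in `Type u`.) -/
def Pre (i : Ordinal.{u}) : Type u :=
  SuccOrder.prelimitRecOn (motive := fun _ => Type u) i
    (fun _ _ X => Set X)
    (fun i _ X => Shrink.{u} (∀ j : Set.Iio i, X j.1 j.2))

/-- Elements of `Pre (i + 1)` are the subsets of `Pre i`. -/
def succEquiv (i : Ordinal.{u}) : Pre (succ i) ≃ Set (Pre i) :=
  Equiv.cast (SuccOrder.prelimitRecOn_succ (motive := fun _ => Type u) _ _ i)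

/-- For a limit `i`, elements of `Pre i` are the families `(x_j)_{j < i}` with `x_j : Pre j`. -/
def limEquiv {i : Ordinal.{u}} (hi : IsSuccPrelimit i) : Pre i ≃ ∀ j : Set.Iio i, Pre j.1 :=
  (Equiv.cast (SuccOrder.prelimitRecOn_of_isSuccPrelimit
    (motive := fun _ => Type u) _ _ hi)).trans (equivShrink.{u} (∀ j : Set.Iio i, Pre j.1)).symm

/-- The set of elements of `a`, for `a` at a successor index. -/
def elems {i : Ordinal.{u}} (a : Pre (succ i)) : Set (Pre i) :=
  succEquiv i a

/-- The component of `a` at `j < i`, for `a` at a limit index `i`. -/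
def comp {i : Ordinal.{u}} (hi : IsSuccPrelimit i) (a : Pre i) (j : Ordinal.{u}) (hj : j < i) :
    Pre j :=
  limEquiv hi a ⟨j, hj⟩

/-! ### The final chain of the restricted powerset functor -/

/-- The connecting map from index `i` to index `j ≤ i`. It sends
* `a` to `{conn b | b ∈ a}`, from `i + 1` to `j + 1`;
* a family to its component at `j`, from a limit `i > j`;
* `a` to the family of the `conn a` from `i` to `k`, for `k < j`, if `j` is a limit. -/
def conn (j : Ordinal.{u}) : ∀ i : Ordinal.{u}, j ≤ i → Pre i → Pre j :=
  SuccOrder.prelimitRecOn (motive := fun j => ∀ i : Ordinal.{u}, j ≤ i → Pre i → Pre j) j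
    (fun j _ connj i =>
      SuccOrder.prelimitRecOn (motive := fun i => succ j ≤ i → Pre i → Pre (succ j)) i
        (fun i _ _ h a => (succEquiv j).symm (connj i (succ_le_succ_iff.mp h) '' elems a))
        (fun _ hi _ h a => comp hi a (succ j) (hi.succ_lt (succ_le_iff.mp h))))
    (fun _ hj connk i h a =>
      (limEquiv hj).symm fun k => connk k.1 k.2 i (k.2.le.trans h) a)

theorem conn_succ_succ {j i : Ordinal.{u}} (h : j ≤ i) (a : Pre (succ i)) :
    elems (conn (succ j) (succ i) (succ_le_succ h) a) = conn j i h '' elems a := by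
  simp [conn, elems]

theorem conn_succ_limit {j i : Ordinal.{u}} (hi : IsSuccPrelimit i) (h : succ j ≤ i) (a : Pre i) :
    conn (succ j) i h a = comp hi a (succ j) (hi.succ_lt (succ_le_iff.mp h)) := by
  simp only [conn, SuccOrder.prelimitRecOn_succ]
  rw [SuccOrder.prelimitRecOn_of_isSuccPrelimit
    (motive := fun i => succ j ≤ i → Pre i → Pre (succ j)) _ _ hi]

theorem comp_conn_limit {j i : Ordinal.{u}} (hj : IsSuccPrelimit j) (h : j ≤ i) (a : Pre i)
    (k : Ordinal.{u}) (hk : k < j) :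
    comp hj (conn j i h a) k hk = conn k i (hk.le.trans h) a := by
  simp only [conn, comp]
  rw [SuccOrder.prelimitRecOn_of_isSuccPrelimit
    (motive := fun j => ∀ i : Ordinal.{u}, j ≤ i → Pre i → Pre j) _ _ hj]
  simp

/-- The `i`-th level of the final chain of `P_{<κ}`.
* At `i + 1` it is `P_{<κ}` of the `i`-th level: the `<κ`-sized subsets of the `i`-th level.
* At a limit `i` it is the set of full branches of the chain of the levels `j < i`: the families of
  elements of the levels that are compatible with the connecting maps. -/
def level (κ : WithTop Cardinal.{u}) (i : Ordinal.{u}) : Set (Pre i) :=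
  SuccOrder.prelimitRecOn (motive := fun i => Set (Pre i)) i
    (fun _ _ L => {a | elems a ⊆ L ∧ SizeLT κ (elems a)})
    (fun _ hi L => {a | (∀ j hj, comp hi a j hj ∈ L j hj) ∧
      ∀ j hj k (hkj : k ≤ j), conn k j hkj (comp hi a j hj) = comp hi a k (hkj.trans_lt hj)})

theorem mem_level_succ {κ : WithTop Cardinal.{u}} {i : Ordinal.{u}} {a : Pre (succ i)} :
    a ∈ level κ (succ i) ↔ elems a ⊆ level κ i ∧ SizeLT κ (elems a) := by
  simp [level]

theorem mem_level_limit {κ : WithTop Cardinal.{u}} {i : Ordinal.{u}} (hi : IsSuccPrelimit i)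
    {a : Pre i} :
    a ∈ level κ i ↔ (∀ j hj, comp hi a j hj ∈ level κ j) ∧
      ∀ j hj k (hkj : k ≤ j), conn k j hkj (comp hi a j hj) = comp hi a k (hkj.trans_lt hj) := by
  simp only [level]
  rw [SuccOrder.prelimitRecOn_of_isSuccPrelimit (motive := fun i => Set (Pre i)) _ _ hi]
  rfl

/-- The transition relation on the `i`-th level, for a limit `i`: `a ⇝ b` when `b_j ∈ a_{j+1}` for
all `j < i`. -/
def Trans {κ : WithTop Cardinal.{u}} {i : Ordinal.{u}} (hi : IsSuccPrelimit i)
    (a b : level κ i) : Prop :=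
  ∀ j (hj : j < i), comp hi b.1 j hj ∈ elems (comp hi a.1 (succ j) (hi.succ_lt hj))

/-- A subset of a transition system is a subsystem when it is closed under successors. -/
def IsSubsystem {X : Type u} (r : X → X → Prop) (U : Set X) : Prop :=
  ∀ x ∈ U, ∀ y, r x y → y ∈ U

/-- The element `0(i)`: empty at successors, the family of the `0(j)` for `j < i` at limits. -/
def zeroAt (i : Ordinal.{u}) : Pre i :=
  SuccOrder.prelimitRecOn (motive := fun i => Pre i) i
    (fun i _ _ => (succEquiv i).symm ∅)
    (fun _ hi z => (limEquiv hi).symm fun j => z j.1 j.2)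

/-! ### Coalgebraic elements and ghosts -/

/-- The `i`-th coalgebra projection of the transition system `(X, ζ)`, where `ζ x` is the set of
successors of `x`: it sends `x` to `{proj i y | y ∈ ζ x}` at `i + 1`, and to the family
`(proj j x)_{j < i}` at a limit `i`. -/
def proj {X : Type u} (ζ : X → Set X) (i : Ordinal.{u}) : X → Pre i :=
  SuccOrder.prelimitRecOn (motive := fun i => X → Pre i) i
    (fun i _ p x => (succEquiv i).symm (p '' ζ x))
    (fun _ hi p x => (limEquiv hi).symm fun j => p j.1 j.2 x)

/-- `a` is `P_{<κ}`-coalgebraic: it is the `i`-th coalgebra projection of a pointed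
`P_{<κ}`-coalgebra, i.e. of a point of a system in which every set of successors is `<κ`-sized. -/
def IsCoalgebraic (κ : WithTop Cardinal.{u}) {i : Ordinal.{u}} (a : Pre i) : Prop :=
  ∃ (X : Type u) (ζ : X → Set X) (x : X), (∀ y, SizeLT κ (ζ y)) ∧ proj ζ i x = a

/-- A `P_{<κ}`-ghost at a limit `i`: an element of the `i`-th level that is `P_{<κ}`-Cauchy (all of
its components are `P_{<κ}`-coalgebraic), is distinct from `0(i)`, and has no successor. -/
def IsGhost {κ : WithTop Cardinal.{u}} {i : Ordinal.{u}} (hi : IsSuccPrelimit i)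
    (a : level κ i) : Prop :=
  (∀ j hj, IsCoalgebraic κ (comp hi a.1 j hj)) ∧ a.1 ≠ zeroAt i ∧ ∀ b, ¬ Trans hi a b

/-! ### Inverse chains, tidy trees, weakly compact cardinals -/

/-- An inverse `I`-chain, i.e. a functor from the opposite of `I` to sets. -/
structure InverseChain (I : Type*) [LinearOrder I] where
  obj : I → Type u
  map : ∀ {j i : I}, j ≤ i → obj i → obj j
  map_refl : ∀ (i : I) (x : obj i), map le_rfl x = x
  map_map : ∀ {k j i : I} (hkj : k ≤ j) (hji : j ≤ i) (x : obj i),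
    map hkj (map hji x) = map (hkj.trans hji) x

/-- A full branch: a family of elements of all levels compatible with the connecting maps. -/
def InverseChain.IsFullBranch {I : Type*} [LinearOrder I] (D : InverseChain.{u} I)
    (x : ∀ i, D.obj i) : Prop :=
  ∀ (j i : I) (h : j ≤ i), D.map h (x i) = x j

/-- A tidy tree: all connecting maps are surjective, a full branch through the levels below a
limit `i` (the least index included) has at most one extension to level `i`, and there is a root. -/
structure InverseChain.IsTidy {I : Type*} [LinearOrder I] (D : InverseChain.{u} I) : Prop where
  surjective : ∀ (j i : I) (h : j ≤ i), Function.Surjective (D.map h)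
  limit : ∀ i : I, IsSuccPrelimit i → ∀ x y : D.obj i,
    (∀ (j : I) (h : j < i), D.map h.le x = D.map h.le y) → x = y
  root : ∃ i : I, IsBot i ∧ Nonempty (D.obj i)

/-- The tree property: every tidy `l`-tree with all levels `<l`-sized has a full branch. -/
def TreeProperty (l : Cardinal.{u}) : Prop :=
  ∀ D : InverseChain.{u} (Set.Iio l.ord), D.IsTidy → (∀ i, Cardinal.mk (D.obj i) < l) →
    ∃ x, D.IsFullBranch x

/-- The ordinal `i` is a weakly compact cardinal: an infinite regular cardinal that is strongly
inaccessible (in the sense that includes `ℵ₀`) and has the tree property. -/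
def IsWeaklyCompact (i : Ordinal.{u}) : Prop :=
  ∃ l : Cardinal.{u}, i = l.ord ∧ l.IsRegular ∧
    (∀ A : Type u, Cardinal.mk A < l → Cardinal.mk (Set A) < l) ∧ TreeProperty l

/-- The ordinal `i` is the supremum of a strictly increasing sequence of ordinals. -/
def IsOmegaCofinal (i : Ordinal.{u}) : Prop :=
  ∃ f : ℕ → Ordinal.{u}, StrictMono f ∧ IsLUB (Set.range f) i

end FinalChain

end

/-! If `i ≥ κ`, regularity suffices. A point has fewer than `κ` successors, so if for each index
below `κ` some successor matches `b` there, a single one matches at all of them. Since in a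
`P_{<κ}`-coalgebra the projection at `κ` determines all others, that one projects to `b`
(`isCoalgebraic_of_trans_of_leOrd`).

If `i < κ`, call an element Cauchy when its components are coalgebraic; successors of Cauchy
elements are Cauchy. If every element of a component of a Cauchy element extends to a successor
(`IsDense`), choosing such successors makes the Cauchy elements a `P_{<κ}`-coalgebra whose
projections are the components, so they are all coalgebraic (`isCoalgebraic_of_isDense`). Such an
extension is a branch of a tree: it is built step by step when `i` is `ω`-cofinal, and comes from
the tree property when `i` is weakly compact.

In the remaining cases a pruned tree of height `i` without branches is coded by well-founded states,
so that a successor of the resulting Cauchy element would be a branch (`exists_isGhost`). If `cof i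
≤ 2^|d|` for some `d < i`, the tree is made of finite subsets of a cofinal set, whose points are
labelled by distinct subsets of `d`; a branch would make `i` `ω`-cofinal. Otherwise `i` is a regular
strong limit cardinal, and failure of weak compactness supplies the tree. Ghosts refute closure
under successors: they are not coalgebraic, but the components' coalgebras, glued under a new root,
give a coalgebraic predecessor. -/

namespace FinalChain

open Order

/-! ### Projections of coalgebras, coalgebraic elements and cardinality bounds -/

section Basics

theorem elems_injective {i : Ordinal.{u}} : Function.Injective (elems (i := i)) :=
  (succEquiv i).injective

theorem comp_ext {i : Ordinal.{u}} (hi : IsSuccPrelimit i) {a b : Pre i}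
    (h : ∀ j hj, comp hi a j hj = comp hi b j hj) : a = b :=
  (limEquiv hi).injective (funext fun j => h j.1 j.2)

/-- The element of the limit level `i` with given components. -/
noncomputable def family {i : Ordinal.{u}} (hi : IsSuccPrelimit i) (x : ∀ j, j < i → Pre j) : Pre i :=
  (limEquiv hi).symm fun j => x j.1 j.2

@[simp]
theorem comp_family {i : Ordinal.{u}} (hi : IsSuccPrelimit i) (x : ∀ j, j < i → Pre j)
    (j : Ordinal.{u}) (hj : j < i) : comp hi (family hi x) j hj = x j hj := by
  simp [comp, family]

theorem elems_zeroAt_succ (i : Ordinal.{u}) : elems (zeroAt (succ i)) = ∅ := by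
  simp [elems, zeroAt]

theorem comp_zeroAt {i : Ordinal.{u}} (hi : IsSuccPrelimit i) (j : Ordinal.{u}) (hj : j < i) :
    comp hi (zeroAt i) j hj = zeroAt j := by
  simp only [zeroAt, comp]
  rw [SuccOrder.prelimitRecOn_of_isSuccPrelimit (motive := fun i => Pre i) _ _ hi]
  simp

variable {X : Type u} {ζ : X → Set X}

theorem elems_proj_succ (ζ : X → Set X) (i : Ordinal.{u}) (x : X) :
    elems (proj ζ (succ i) x) = proj ζ i '' ζ x := by
  simp [elems, proj]

theorem comp_proj (ζ : X → Set X) {i : Ordinal.{u}} (hi : IsSuccPrelimit i) (x : X)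
    (j : Ordinal.{u}) (hj : j < i) : comp hi (proj ζ i x) j hj = proj ζ j x := by
  simp only [proj, comp]
  rw [SuccOrder.prelimitRecOn_of_isSuccPrelimit (motive := fun i => X → Pre i) _ _ hi]
  simp

theorem proj_succ_eq_iff {Y : Type u} {ξ : Y → Set Y} {k : Ordinal.{u}} {x : X} {y : Y} :
    proj ζ (succ k) x = proj ξ (succ k) y ↔ proj ζ k '' ζ x = proj ξ k '' ξ y := by
  rw [← elems_injective.eq_iff, elems_proj_succ, elems_proj_succ]

theorem proj_limit_eq_iff {Y : Type u} {ξ : Y → Set Y} {k : Ordinal.{u}}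
    (hk : IsSuccPrelimit k) {x : X} {y : Y} :
    proj ζ k x = proj ξ k y ↔ ∀ j < k, proj ζ j x = proj ξ j y := by
  refine ⟨fun h j hj => ?_, fun h => comp_ext hk fun j hj => ?_⟩
  · rw [← comp_proj ζ hk x j hj, h, comp_proj]
  · rw [comp_proj, comp_proj, h j hj]

theorem conn_proj (ζ : X → Set X) (j i : Ordinal.{u}) (h : j ≤ i) (x : X) :
    conn j i h (proj ζ i x) = proj ζ j x := by
  induction j using SuccOrder.prelimitRecOn generalizing i x with
  | succ j _ ih =>
    induction i using SuccOrder.prelimitRecOn with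
    | succ i _ _ =>
      have h' : j ≤ i := succ_le_succ_iff.mp h
      apply elems_injective
      rw [conn_succ_succ h', elems_proj_succ, elems_proj_succ, Set.image_image]
      exact Set.image_congr fun y _ => ih i h' y
    | isSuccPrelimit i hi _ => rw [conn_succ_limit hi, comp_proj]
  | isSuccPrelimit j hj ih =>
    refine comp_ext hj fun k hk => ?_
    rw [comp_conn_limit, comp_proj]
    exact ih k hk _ _ _

theorem proj_eq_of_le {Y : Type u} {ξ : Y → Set Y} {j k : Ordinal.{u}} (h : j ≤ k) {x : X} {y : Y}
    (e : proj ζ k x = proj ξ k y) : proj ζ j x = proj ξ j y := by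
  rw [← conn_proj ζ j k h, e, conn_proj]

/-- Coalgebra morphisms preserve the projections. -/
theorem proj_morphism {Y : Type u} {ξ : Y → Set Y} (f : X → Y) (hf : ∀ x, ξ (f x) = f '' ζ x)
    (k : Ordinal.{u}) (x : X) : proj ξ k (f x) = proj ζ k x := by
  induction k using SuccOrder.prelimitRecOn generalizing x with
  | succ k _ ih =>
    rw [proj_succ_eq_iff, hf, Set.image_image]
    exact Set.image_congr fun y _ => ih y
  | isSuccPrelimit k hk ih => exact (proj_limit_eq_iff hk).mpr fun j hj => ih j hj x

variable {κ : WithTop Cardinal.{u}}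

theorem SizeLT.mono {α : Type u} {s t : Set α} (hst : s ⊆ t) (ht : SizeLT κ t) : SizeLT κ s :=
  lt_of_le_of_lt (WithTop.coe_le_coe.mpr (Cardinal.mk_le_mk_of_subset hst)) ht

theorem SizeLT.image {α β : Type u} {s : Set α} (f : α → β) (hs : SizeLT κ s) :
    SizeLT κ (f '' s) :=
  lt_of_le_of_lt (WithTop.coe_le_coe.mpr Cardinal.mk_image_le) hs

theorem sizeLT_of_mk_lt {α : Type u} (h : (Cardinal.mk α : WithTop Cardinal.{u}) < κ)
    (s : Set α) : SizeLT κ s :=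
  lt_of_le_of_lt (WithTop.coe_le_coe.mpr (Cardinal.mk_set_le s)) h

theorem proj_mem_level (hζ : ∀ x, SizeLT κ (ζ x)) (k : Ordinal.{u}) (x : X) :
    proj ζ k x ∈ level κ k := by
  induction k using SuccOrder.prelimitRecOn generalizing x with
  | succ k _ ih =>
    rw [mem_level_succ, elems_proj_succ]
    refine ⟨?_, (hζ x).image _⟩
    rintro _ ⟨y, _, rfl⟩
    exact ih y
  | isSuccPrelimit k hk ih =>
    rw [mem_level_limit hk]
    refine ⟨fun j hj => ?_, fun j hj l hl => ?_⟩
    · rw [comp_proj]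
      exact ih j hj x
    · rw [comp_proj, comp_proj, conn_proj]

namespace IsCoalgebraic

variable {i : Ordinal.{u}}

theorem proj_mk (hζ : ∀ x, SizeLT κ (ζ x)) (k : Ordinal.{u}) (x : X) :
    IsCoalgebraic κ (proj ζ k x) :=
  ⟨X, ζ, x, hζ, rfl⟩

theorem of_mem_elems {a : Pre (succ i)} (ha : IsCoalgebraic κ a) {b : Pre i} (hb : b ∈ elems a) :
    IsCoalgebraic κ b := by
  obtain ⟨X, ζ, x, hζ, rfl⟩ := ha
  rw [elems_proj_succ] at hb
  obtain ⟨y, _, rfl⟩ := hb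
  exact proj_mk hζ i y

theorem comp {hi : IsSuccPrelimit i} {a : Pre i} (ha : IsCoalgebraic κ a) (j : Ordinal.{u})
    (hj : j < i) : IsCoalgebraic κ (comp hi a j hj) := by
  obtain ⟨X, ζ, x, hζ, rfl⟩ := ha
  rw [comp_proj]
  exact proj_mk hζ j x

theorem conn {a : Pre i} (ha : IsCoalgebraic κ a) (j : Ordinal.{u}) (h : j ≤ i) :
    IsCoalgebraic κ (conn j i h a) := by
  obtain ⟨X, ζ, x, hζ, rfl⟩ := ha
  rw [conn_proj]
  exact proj_mk hζ j x

theorem mem_level {a : Pre i} (ha : IsCoalgebraic κ a) : a ∈ level κ i := by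
  obtain ⟨X, ζ, x, hζ, rfl⟩ := ha
  exact proj_mem_level hζ i x

/-- The composition law fails on incompatible families in `Pre i`; coalgebraic elements inherit it
from `conn_proj`. -/
theorem conn_conn {a : Pre i} (ha : IsCoalgebraic κ a) {k j : Ordinal.{u}} (hk : k ≤ j)
    (hj : j ≤ i) :
    FinalChain.conn k j hk (FinalChain.conn j i hj a) = FinalChain.conn k i (hk.trans hj) a := by
  obtain ⟨X, ζ, x, hζ, rfl⟩ := ha
  simp only [conn_proj]

theorem conn_refl {a : Pre i} (ha : IsCoalgebraic κ a) : FinalChain.conn i i le_rfl a = a := by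
  obtain ⟨X, ζ, x, hζ, rfl⟩ := ha
  simp only [conn_proj]

theorem comp_eq_conn {hi : IsSuccPrelimit i} {a : Pre i} (ha : IsCoalgebraic κ a)
    (j : Ordinal.{u}) (hj : j < i) : FinalChain.comp hi a j hj = FinalChain.conn j i hj.le a := by
  obtain ⟨X, ζ, x, hζ, rfl⟩ := ha
  rw [conn_proj, comp_proj]

end IsCoalgebraic

section Limit

variable {i : Ordinal.{u}} {hi : IsSuccPrelimit i}

/-- For compatible families, the elements at a smaller index are the images of the elements at a
larger one. -/
theorem conn_image_elems_comp {b : Pre i} (hb : b ∈ level κ i) {j k : Ordinal.{u}} (hjk : j ≤ k)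
    (hk : k < i) :
    conn j k hjk '' elems (comp hi b (succ k) (hi.succ_lt hk)) =
      elems (comp hi b (succ j) (hi.succ_lt (hjk.trans_lt hk))) := by
  rw [← conn_succ_succ, ((mem_level_limit hi).mp hb).2]

/-- The successors of an element with coalgebraic components again have coalgebraic components. -/
theorem Trans.isCoalgebraic_comp {a b : level κ i} (h : Trans hi a b)
    (ha : ∀ j hj, IsCoalgebraic κ (comp hi a.1 j hj)) (j : Ordinal.{u}) (hj : j < i) :
    IsCoalgebraic κ (comp hi b.1 j hj) :=
  (ha _ _).of_mem_elems (h j hj)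

end Limit

section Cardinality

theorem mk_shrink_Iio (i : Ordinal.{u}) : Cardinal.mk (Shrink.{u} (Set.Iio i)) = i.card := by
  have h : Cardinal.lift.{u + 1} (Cardinal.mk (Shrink.{u} (Set.Iio i))) =
      Cardinal.mk (Set.Iio i) := by
    rw [← Cardinal.lift_id (Cardinal.mk (Set.Iio i)), ← Cardinal.lift_umax]
    exact (Cardinal.lift_mk_eq'.mpr ⟨(equivShrink _).symm⟩).trans (by simp)
  rw [Cardinal.mk_Iio_ordinal] at h
  exact Cardinal.lift_injective h

theorem card_lt_of_not_leOrd {i : Ordinal.{u}} (hκ : InfiniteRegular κ) (h : ¬ LEOrd κ i) :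
    (i.card : WithTop Cardinal.{u}) < κ := by
  rcases hκ with rfl | ⟨c, rfl, hc⟩
  · exact WithTop.coe_lt_top _
  · rw [WithTop.coe_lt_coe, ← Cardinal.lt_ord]
    by_contra h'
    exact h ⟨c, rfl, not_lt.mp h'⟩

theorem InfiniteRegular.sizeLT_iUnion (hκ : InfiniteRegular κ) {ι α : Type u} {t : ι → Set α}
    (hι : (Cardinal.mk ι : WithTop Cardinal.{u}) < κ) (ht : ∀ n, SizeLT κ (t n)) :
    SizeLT κ (⋃ n, t n) := by
  rcases hκ with rfl | ⟨c, rfl, hc⟩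
  · exact WithTop.coe_lt_top _
  · rw [SizeLT, WithTop.coe_lt_coe,
      Cardinal.card_iUnion_lt_iff_forall_of_isRegular hc (WithTop.coe_lt_coe.mp hι)]
    exact fun n => WithTop.coe_lt_coe.mp (ht n)

theorem InfiniteRegular.sizeLT_of_finite (hκ : InfiniteRegular κ) {α : Type u} {s : Set α}
    (hs : s.Finite) : SizeLT κ s := by
  have := hs.to_subtype
  rcases hκ with rfl | ⟨c, rfl, hc⟩
  · exact WithTop.coe_lt_top _
  · exact WithTop.coe_lt_coe.mpr ((Cardinal.lt_aleph0_of_finite s).trans_le hc.aleph0_le)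

end Cardinality

end Basics

/-! ### Indices at or above `κ` -/

section LargeIndex

/-- A decreasing family of `c` conditions, each of which is met in a set of size `< c`, is met
simultaneously. -/
theorem exists_forall_of_forall_exists {c : Cardinal.{u}} (hc : c.IsRegular) {X : Type u}
    {S : Set X} (hS : Cardinal.mk S < c) (P : X → Ordinal.{u} → Prop)
    (hP : ∀ y j k, j ≤ k → P y k → P y j) (h : ∀ k < c.ord, ∃ y ∈ S, P y k) :
    ∃ y ∈ S, ∀ k < c.ord, P y k := by
  by_contra! hn
  choose! f hf hfP using hn
  -- By regularity, the indices at which the various `y` fail have a common bound below `c.ord`; the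
  -- `y` that works at the bound works where it should fail.
  have hlt : ⨆ y : S, f y < c.ord :=
    Ordinal.iSup_lt_of_lt_cof (by rwa [hc.cof_ord]) fun y => hf y y.2
  obtain ⟨y, hy, hyP⟩ := h _ hlt
  exact hfP y hy (hP y _ _ (Ordinal.le_iSup (fun y : S => f y) ⟨y, hy⟩) hyP)

theorem isSuccPrelimit_ord {c : Cardinal.{u}} (hc : c.IsRegular) : IsSuccPrelimit c.ord :=
  (Cardinal.isSuccLimit_ord hc.aleph0_le).isSuccPrelimit

/-- In a `P_{<c}`-coalgebra, points with the same projection at `c` have the same projections. -/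
theorem proj_eq_of_proj_ord_eq {c : Cardinal.{u}} (hc : c.IsRegular) {X : Type u} {ζ : X → Set X}
    (hζ : ∀ x, Cardinal.mk (ζ x) < c) {y z : X} (h : proj ζ c.ord y = proj ζ c.ord z)
    (j : Ordinal.{u}) : proj ζ j y = proj ζ j z := by
  -- Equality of projections at `c.ord` is a bisimulation.
  have key : ∀ y z, proj ζ c.ord y = proj ζ c.ord z →
      ∀ y' ∈ ζ y, ∃ z' ∈ ζ z, proj ζ c.ord y' = proj ζ c.ord z' := by
    intro y z h y' hy'
    obtain ⟨z', hz', h'⟩ := exists_forall_of_forall_exists hc (hζ z)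
      (fun z' k => proj ζ k y' = proj ζ k z') (fun z' j k hjk e => proj_eq_of_le hjk e)
      (fun k hk => by
        have e := proj_eq_of_le ((isSuccPrelimit_ord hc).succ_lt hk).le h
        rw [proj_succ_eq_iff] at e
        obtain ⟨z', hz', e'⟩ := e.subset ⟨y', hy', rfl⟩
        exact ⟨z', hz', e'.symm⟩)
    exact ⟨z', hz', (proj_limit_eq_iff (isSuccPrelimit_ord hc)).mpr h'⟩
  induction j using SuccOrder.prelimitRecOn generalizing y z with
  | succ j _ ih =>
    rw [proj_succ_eq_iff]
    apply Set.Subset.antisymm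
    · rintro _ ⟨y', hy', rfl⟩
      obtain ⟨z', hz', e⟩ := key y z h y' hy'
      exact ⟨z', hz', ih e.symm⟩
    · rintro _ ⟨z', hz', rfl⟩
      obtain ⟨y', hy', e⟩ := key z y h.symm z' hz'
      exact ⟨y', hy', ih e.symm⟩
  | isSuccPrelimit j hj ih => exact (proj_limit_eq_iff hj).mpr fun k hk => ih k hk h

/-- With `a` the projection of `x`, one successor `y` of `x` matches `b` at all indices below
`c.ord`. At a later `j`, the successor `z` that matches `b` at `j` agrees with `y` at `c.ord`, hence
at `j`. -/
theorem isCoalgebraic_of_trans_of_leOrd {κ : WithTop Cardinal.{u}} (hκ : InfiniteRegular κ)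
    {i : Ordinal.{u}} (hi : IsSuccPrelimit i) (hle : LEOrd κ i) {a b : level κ i}
    (hab : Trans hi a b) (ha : IsCoalgebraic κ a.1) : IsCoalgebraic κ b.1 := by
  obtain ⟨c, rfl, hci⟩ := hle
  have hc : c.IsRegular := by
    rcases hκ with h | ⟨d, h, hd⟩
    · exact absurd h WithTop.coe_ne_top
    · rwa [WithTop.coe_injective h]
  obtain ⟨X, ζ, x, hζ, hx⟩ := ha
  have hζ' : ∀ x, Cardinal.mk (ζ x) < c := fun x => WithTop.coe_lt_coe.mp (hζ x)
  have hmem : ∀ j (hj : j < i), ∃ y ∈ ζ x, proj ζ j y = comp hi b.1 j hj := by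
    intro j hj
    have := hab j hj
    rwa [← hx, comp_proj, elems_proj_succ] at this
  have hcomp : ∀ j k (hjk : j ≤ k) (hk : k < i) y, proj ζ k y = comp hi b.1 k hk →
      proj ζ j y = comp hi b.1 j (hjk.trans_lt hk) := by
    intro j k hjk hk y e
    rw [← ((mem_level_limit hi).mp b.2).2 k hk j hjk, ← e, conn_proj]
  obtain ⟨y, -, hyb⟩ := exists_forall_of_forall_exists hc (hζ' x)
    (fun y k => ∀ j ≤ k, ∀ hj : j < i, proj ζ j y = comp hi b.1 j hj)
    (fun y j k hjk h l hl => h l (hl.trans hjk))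
    (fun k hk => by
      obtain ⟨y, hy, e⟩ := hmem k (hk.trans_le hci)
      exact ⟨y, hy, fun j hj _ => hcomp j k hj _ y e⟩)
  refine ⟨X, ζ, y, hζ, comp_ext hi fun j hj => ?_⟩
  rw [comp_proj]
  rcases lt_or_ge j c.ord with hjc | hjc
  · exact hyb j hjc j le_rfl hj
  · obtain ⟨z, -, hz⟩ := hmem j hj
    rw [← hz]
    refine proj_eq_of_proj_ord_eq hc hζ' ?_ j
    refine (proj_limit_eq_iff (isSuccPrelimit_ord hc)).mpr fun k hk => ?_
    rw [hyb k hk k le_rfl (hk.trans_le hci), hcomp k j (hk.le.trans hjc) hj z hz]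

end LargeIndex

/-! ### Indices below `κ`: extending elements of components to successors -/

section SmallIndex

variable {κ : WithTop Cardinal.{u}} {i : Ordinal.{u}} {hi : IsSuccPrelimit i}

/-- `b` has a successor through each element of each of its components. -/
def IsDense (hi : IsSuccPrelimit i) (b : level κ i) : Prop :=
  ∀ j (hj : j < i), ∀ w ∈ elems (comp hi b.1 (succ j) (hi.succ_lt hj)),
    ∃ c : level κ i, Trans hi b c ∧ comp hi c.1 j hj = w

/-- If each Cauchy element of the level `i < κ` has enough successors, then the Cauchy elements
carry a coalgebra, and so they are coalgebraic. -/
theorem isCoalgebraic_of_isDense (hκ : InfiniteRegular κ)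
    (hcard : (i.card : WithTop Cardinal.{u}) < κ)
    (hdense : ∀ b : level κ i, (∀ j hj, IsCoalgebraic κ (comp hi b.1 j hj)) → IsDense hi b)
    (b : level κ i) (hb : ∀ j hj, IsCoalgebraic κ (comp hi b.1 j hj)) : IsCoalgebraic κ b.1 := by
  let X := {b : level κ i // ∀ j hj, IsCoalgebraic κ (comp hi b.1 j hj)}
  have hX : ∀ (b : X) (j : Ordinal.{u}) (hj : j < i)
      (w : elems (comp hi b.1.1 (succ j) (hi.succ_lt hj))),
      ∃ c : X, Trans hi b.1 c.1 ∧ comp hi c.1.1 j hj = w.1 := fun b j hj w => by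
    obtain ⟨c, hc, e⟩ := hdense b.1 b.2 j hj w.1 w.2
    exact ⟨⟨c, hc.isCoalgebraic_comp b.2⟩, hc, e⟩
  choose f hf hfw using hX
  let t : Shrink.{u} (Set.Iio i) → Set.Iio i := (equivShrink _).symm
  -- Taking all successors might exceed `κ`; one chosen successor for each `j < i` and each element
  -- of the `j + 1` component is enough to recover the components.
  let ζ : X → Set X := fun b => ⋃ n, Set.range (f b (t n).1 (t n).2)
  have hζ : ∀ b, SizeLT κ (ζ b) := fun b => by
    refine hκ.sizeLT_iUnion (by rwa [mk_shrink_Iio]) fun n => ?_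
    refine lt_of_le_of_lt (WithTop.coe_le_coe.mpr Cardinal.mk_range_le) ?_
    exact (mem_level_succ.mp (((mem_level_limit hi).mp b.1.2).1 _ _)).2
  have hproj : ∀ j (hj : j < i) (b : X), proj ζ j b = comp hi b.1.1 j hj := by
    intro j
    induction j using SuccOrder.prelimitRecOn with
    | succ j _ ih =>
      intro hj b
      have hj' : j < i := (lt_succ j).trans hj
      apply elems_injective
      rw [elems_proj_succ, Set.image_congr fun c _ => ih hj' c]
      apply Set.Subset.antisymm
      · rintro _ ⟨c, hc, rfl⟩
        obtain ⟨n, w, rfl⟩ := Set.mem_iUnion.mp hc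
        exact hf b _ _ w j hj'
      · intro w hw
        refine ⟨f b j hj' ⟨w, hw⟩, Set.mem_iUnion.mpr ⟨equivShrink _ ⟨j, hj'⟩, ?_⟩, hfw b j hj' _⟩
        have e : t (equivShrink _ ⟨j, hj'⟩) = ⟨j, hj'⟩ := by simp [t]
        rw [e]
        exact Set.mem_range_self _
    | isSuccPrelimit j hjl ih =>
      intro hj b
      refine comp_ext hjl fun k hk => ?_
      rw [comp_proj, ih k hk (hk.trans hj), (b.2 j hj).comp_eq_conn,
        ((mem_level_limit hi).mp b.1.2).2 j hj k]
  refine ⟨X, ζ, ⟨b, hb⟩, hζ, comp_ext hi fun j hj => ?_⟩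
  rw [comp_proj, hproj j hj]

/-- Compatible elements of cofinally many components of a Cauchy element yield a successor. -/
theorem exists_trans_of_cofinal {b : level κ i} (hb : ∀ j hj, IsCoalgebraic κ (comp hi b.1 j hj))
    {ι : Type*} [LinearOrder ι] (g : ι → Ordinal.{u}) (hg : Monotone g) (hgi : ∀ n, g n < i)
    (hcof : ∀ k < i, ∃ n, k ≤ g n) (u : ∀ n, Pre (g n))
    (hu : ∀ n, u n ∈ elems (comp hi b.1 (succ (g n)) (hi.succ_lt (hgi n))))
    (huu : ∀ n m (h : n ≤ m), conn (g n) (g m) (hg h) (u m) = u n) :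
    ∃ c : level κ i, Trans hi b c ∧
      ∀ n j (hj : j ≤ g n), comp hi c.1 j (hj.trans_lt (hgi n)) = conn j (g n) hj (u n) := by
  have hcoal : ∀ n, IsCoalgebraic κ (u n) := fun n => (hb _ _).of_mem_elems (hu n)
  choose N hN using hcof
  have heq : ∀ n m j (hn : j ≤ g n) (hm : j ≤ g m), conn j _ hn (u n) = conn j _ hm (u m) := by
    intro n m j hn hm
    rcases le_total n m with h | h
    · rw [← huu n m h, (hcoal m).conn_conn]
    · rw [← huu m n h, (hcoal n).conn_conn]
  let x : ∀ j, j < i → Pre j := fun j hj => conn j (g (N j hj)) (hN j hj) (u (N j hj))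
  have hx : ∀ j hj, x j hj ∈ elems (comp hi b.1 (succ j) (hi.succ_lt hj)) := fun j hj => by
    rw [← conn_image_elems_comp b.2 (hN j hj) (hgi _)]
    exact ⟨_, hu _, rfl⟩
  refine ⟨⟨family hi x, (mem_level_limit hi).mpr ⟨fun j hj => ?_, fun j hj k hk => ?_⟩⟩,
    fun j hj => ?_, fun n j hj => ?_⟩
  · rw [comp_family]
    exact ((hcoal _).conn _ _).mem_level
  · rw [comp_family, comp_family, (hcoal _).conn_conn]
    exact heq _ _ _ _ _
  · rw [comp_family]
    exact hx j hj
  · rw [comp_family]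
    exact heq _ _ _ _ _

theorem exists_conn_eq_of_mem_elems {b : Pre i} (hb : b ∈ level κ i) {j k : Ordinal.{u}}
    (hjk : j ≤ k) (hk : k < i) {w : Pre j}
    (hw : w ∈ elems (comp hi b (succ j) (hi.succ_lt (hjk.trans_lt hk)))) :
    ∃ v ∈ elems (comp hi b (succ k) (hi.succ_lt hk)), conn j k hjk v = w := by
  rwa [← conn_image_elems_comp hb hjk hk] at hw

/-- Starting from `w`, elements are lifted one at a time along a cofinal sequence; no limit stage
below `i` has to be crossed. -/
theorem isDense_of_isOmegaCofinal (hω : IsOmegaCofinal i) (b : level κ i)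
    (hb : ∀ j hj, IsCoalgebraic κ (comp hi b.1 j hj)) : IsDense hi b := by
  obtain ⟨f, hf, hfi⟩ := hω
  intro j hj w hw
  have hflt : ∀ n, f n < i := fun n => (hf n.lt_succ_self).trans_le (hfi.1 ⟨n + 1, rfl⟩)
  let g : ℕ → Ordinal.{u} := fun n => max j (f n)
  have hg : Monotone g := fun n m h => max_le_max le_rfl (hf.monotone h)
  have hgi : ∀ n, g n < i := fun n => max_lt hj (hflt n)
  let E : ℕ → Type u := fun n => elems (comp hi b.1 (succ (g n)) (hi.succ_lt (hgi n)))
  have hstep : ∀ n (v : E n), ∃ v' : E (n + 1), conn (g n) (g (n + 1)) (hg n.le_succ) v'.1 = v.1 :=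
    fun n v => by
      obtain ⟨v', hv', e⟩ := exists_conn_eq_of_mem_elems b.2 (hg n.le_succ) (hgi _) v.2
      exact ⟨⟨v', hv'⟩, e⟩
  choose next hnext using hstep
  have h0 : ∃ v : E 0, conn j (g 0) (le_max_left _ _) v.1 = w := by
    obtain ⟨v', hv', e⟩ := exists_conn_eq_of_mem_elems b.2 (le_max_left j (f 0)) (hgi 0) hw
    exact ⟨⟨v', hv'⟩, e⟩
  obtain ⟨v0, hv0⟩ := h0
  let u : ∀ n, E n := fun n => Nat.rec v0 next n
  have hcoal : ∀ n, IsCoalgebraic κ (u n).1 := fun n => (hb _ _).of_mem_elems (u n).2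
  have huu : ∀ n m (h : n ≤ m), conn (g n) (g m) (hg h) (u m).1 = (u n).1 := by
    intro n m h
    induction m, h using Nat.le_induction with
    | base => exact (hcoal n).conn_refl
    | succ m h ih =>
      rw [← ih, ← hnext m (u m)]
      exact ((hcoal (m + 1)).conn_conn (hg h) (hg m.le_succ)).symm
  obtain ⟨c, hc, hcu⟩ := exists_trans_of_cofinal hb g hg hgi (fun k hk => by
    by_contra! h
    exact hk.not_ge (hfi.2 (by
      rintro _ ⟨n, rfl⟩
      exact ((le_max_right _ _).trans_lt (h n)).le))) (fun n => (u n).1) (fun n => (u n).2) huu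
  exact ⟨c, hc, by rw [hcu 0 j (le_max_left _ _)]; exact hv0⟩

/-- A dependent function is determined by its graph, a subset of a sum of size `< l`. -/
theorem mk_pi_lt {l : Cardinal.{u}} (hl : l.IsRegular)
    (hpow : ∀ A : Type u, Cardinal.mk A < l → Cardinal.mk (Set A) < l) {ι : Type u}
    (hι : Cardinal.mk ι < l) {α : ι → Type u} (hα : ∀ n, Cardinal.mk (α n) < l) :
    Cardinal.mk (∀ n, α n) < l := by
  have h : Cardinal.mk (Σ n, α n) < l := by
    rw [Cardinal.mk_sigma]
    exact Cardinal.sum_lt_of_isRegular hl hι hα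
  refine (Cardinal.mk_le_of_injective (f := fun f : ∀ n, α n => Set.range fun n =>
    (⟨n, f n⟩ : Σ n, α n)) fun f f' e => funext fun n => ?_).trans_lt (hpow _ h)
  obtain ⟨m, hm⟩ : (⟨n, f n⟩ : Σ n, α n) ∈ Set.range fun n => (⟨n, f' n⟩ : Σ n, α n) :=
    e.subset ⟨n, rfl⟩
  obtain ⟨rfl, hm⟩ := Sigma.mk.inj_iff.mp hm
  exact (eq_of_heq hm).symm

theorem mk_pre_lt {l : Cardinal.{u}} (hl : l.IsRegular)
    (hpow : ∀ A : Type u, Cardinal.mk A < l → Cardinal.mk (Set A) < l) (k : Ordinal.{u})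
    (hk : k < l.ord) : Cardinal.mk (Pre k) < l := by
  induction k using SuccOrder.prelimitRecOn with
  | succ k _ ih =>
    rw [Cardinal.mk_congr (succEquiv k)]
    exact hpow _ (ih ((lt_succ k).trans hk))
  | isSuccPrelimit k hkl ih =>
    have e : Pre k ≃ ∀ n : Shrink.{u} (Set.Iio k), Pre ((equivShrink _).symm n).1 :=
      (limEquiv hkl).trans (Equiv.piCongrLeft' _ (equivShrink _))
    rw [Cardinal.mk_congr e]
    refine mk_pi_lt hl hpow ?_ fun n => ih _ ((equivShrink _).symm n).2
      (((equivShrink _).symm n).2.trans hk)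
    rw [mk_shrink_Iio]
    exact Cardinal.lt_ord.mp hk

theorem eq_of_conn_eq {j m : Ordinal.{u}} {h : j ≤ m} (h' : m ≤ j) {x y : Pre m}
    (hx : IsCoalgebraic κ x) (hy : IsCoalgebraic κ y) (e : conn j m h x = conn j m h y) :
    x = y := by
  obtain rfl := le_antisymm h h'
  rwa [hx.conn_refl, hy.conn_refl] at e

theorem eq_of_forall_conn_eq {m : Ordinal.{u}} (hm : IsSuccPrelimit m) {x y : Pre m}
    (hx : IsCoalgebraic κ x) (hy : IsCoalgebraic κ y)
    (h : ∀ n < m, ∃ k, n ≤ k ∧ ∃ hk : k ≤ m, conn k m hk x = conn k m hk y) : x = y := by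
  refine comp_ext hm fun n hn => ?_
  obtain ⟨k, hnk, hk, e⟩ := h n hn
  rw [hx.comp_eq_conn, hy.comp_eq_conn, ← hx.conn_conn hnk hk, e, hy.conn_conn]

theorem isSuccPrelimit_coe_of_Iio {o : Ordinal.{u}} {k : Set.Iio o} (hk : IsSuccPrelimit k) :
    IsSuccPrelimit k.1 := fun n hn =>
  hk ⟨n, hn.lt.trans k.2⟩ ⟨hn.lt, fun _ h h' => hn.2 h h'⟩

/-- The elements of the components of `b` lying over `w` form a tidy tree with small levels, and a
full branch of it is a successor through `w`. -/
theorem isDense_of_isWeaklyCompact (hwc : IsWeaklyCompact i) (b : level κ i)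
    (hb : ∀ j hj, IsCoalgebraic κ (comp hi b.1 j hj)) : IsDense hi b := by
  obtain ⟨l, rfl, hl, hpow, htree⟩ := hwc
  intro j hj w hw
  let g : Set.Iio l.ord → Ordinal.{u} := fun k => max j k.1
  have hg : Monotone g := fun n m h => max_le_max le_rfl h
  have hgi : ∀ n, g n < l.ord := fun n => max_lt hj n.2
  have hcoal : ∀ {n} {u : Pre (g n)}, u ∈ elems (comp hi b.1 (succ (g n)) (hi.succ_lt (hgi n))) →
    IsCoalgebraic κ u := fun hu => (hb _ _).of_mem_elems hu
  let D : InverseChain.{u} (Set.Iio l.ord) :=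
    { obj := fun k => {u : Pre (g k) // u ∈ elems (comp hi b.1 (succ (g k)) (hi.succ_lt (hgi k))) ∧
        conn j (g k) (le_max_left _ _) u = w}
      map := fun {k m} h u => ⟨conn (g k) (g m) (hg h) u.1, by
        rw [← conn_image_elems_comp b.2 (hg h) (hgi _)]
        exact ⟨_, u.2.1, rfl⟩, by rw [(hcoal u.2.1).conn_conn, u.2.2]⟩
      map_refl := fun k u => Subtype.ext (hcoal u.2.1).conn_refl
      map_map := fun h h' u => Subtype.ext ((hcoal u.2.1).conn_conn _ _) }
  have hD : D.IsTidy :=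
    { surjective := fun k m h u => by
        obtain ⟨v, hv, e⟩ := exists_conn_eq_of_mem_elems b.2 (hg h) (hgi _) u.2.1
        refine ⟨⟨v, hv, ?_⟩, Subtype.ext e⟩
        rw [← (hcoal hv).conn_conn (le_max_left _ _) (hg h), e, u.2.2]
      limit := fun k hk x y hxy => by
        -- Up to height `j` the levels are all `{w}`, so uniqueness is automatic; beyond `j`, the
        -- index `g k` is `k` itself, a limit.
        rcases le_or_gt k.1 j with hkj | hkj
        · exact Subtype.ext (eq_of_conn_eq (max_le le_rfl hkj) (hcoal x.2.1) (hcoal y.2.1)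
            (x.2.2.trans y.2.2.symm))
        · have hgk : g k = k.1 := max_eq_right hkj.le
          refine Subtype.ext (eq_of_forall_conn_eq ?_ (hcoal x.2.1) (hcoal y.2.1)
            fun n hn => ?_)
          · rw [hgk]
            exact isSuccPrelimit_coe_of_Iio hk
          · have hn' : max n j < k.1 := max_lt (hn.trans_eq hgk) hkj
            have e := congrArg Subtype.val (hxy ⟨max n j, hn'.trans k.2⟩ hn')
            exact ⟨_, (le_max_left n j).trans (le_max_right _ _), _, e⟩
      root := by
        refine ⟨⟨0, hl.ord_pos⟩, fun k => Subtype.coe_le_coe.mp (zero_le), ?_⟩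
        obtain ⟨v, hv, e⟩ := exists_conn_eq_of_mem_elems b.2 (le_max_left j 0)
          (max_lt hj hl.ord_pos) hw
        exact ⟨⟨v, hv, e⟩⟩ }
  obtain ⟨x, hx⟩ := htree D hD fun k =>
    (Cardinal.mk_subtype_le _).trans_lt (mk_pre_lt hl hpow _ (hgi k))
  obtain ⟨c, hc, hcu⟩ := exists_trans_of_cofinal hb g hg hgi
    (fun k hk => ⟨⟨k, hk⟩, le_max_right _ _⟩) (fun n => (x n).1) (fun n => (x n).2.1)
    (fun n m h => congrArg Subtype.val (hx n m h))
  refine ⟨c, hc, ?_⟩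
  rw [hcu ⟨0, hl.ord_pos⟩ j (le_max_left _ _)]
  exact (x _).2.2

end SmallIndex

/-! ### Ghosts are not coalgebraic, but have coalgebraic predecessors -/

section Ghosts

variable {κ : WithTop Cardinal.{u}} {i : Ordinal.{u}} {hi : IsSuccPrelimit i}

theorem proj_eq_zeroAt {X : Type u} {ζ : X → Set X} {x : X} (h : ζ x = ∅) (i : Ordinal.{u}) :
    proj ζ i x = zeroAt i := by
  induction i using SuccOrder.prelimitRecOn with
  | succ i _ _ =>
    apply elems_injective
    rw [elems_proj_succ, elems_zeroAt_succ, h, Set.image_empty]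
  | isSuccPrelimit i hi ih =>
    refine comp_ext hi fun j hj => ?_
    rw [comp_proj, comp_zeroAt, ih j hj]

/-- A point without successors projects to `0(i)`; any successor of a point projects to a successor
of its projection. -/
theorem IsGhost.not_isCoalgebraic {a : level κ i} (ha : IsGhost hi a) :
    ¬ IsCoalgebraic κ a.1 := by
  rintro ⟨X, ζ, x, hζ, hx⟩
  rcases (ζ x).eq_empty_or_nonempty with h | ⟨y, hy⟩
  · exact ha.2.1 (hx.symm.trans (proj_eq_zeroAt h i))
  · refine ha.2.2 ⟨proj ζ i y, proj_mem_level hζ i y⟩ fun j hj => ?_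
    simp only [← hx, comp_proj, elems_proj_succ]
    exact ⟨y, hy, rfl⟩

/-- Each element of the limit level `i < κ` with coalgebraic components is a successor of a
coalgebraic element. -/
theorem exists_isCoalgebraic_trans (hcard : (i.card : WithTop Cardinal.{u}) < κ) (a : level κ i)
    (ha : ∀ j hj, IsCoalgebraic κ (comp hi a.1 j hj)) :
    ∃ c : level κ i, IsCoalgebraic κ c.1 ∧ Trans hi c a := by
  choose X ζ x hζ hx using ha
  let t : Shrink.{u} (Set.Iio i) → Set.Iio i := (equivShrink _).symm
  -- The disjoint union of coalgebras realizing the components, with a new root `none` above the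
  -- realizing points.
  let Y := Option (Σ n, X (t n).1 (t n).2)
  let ξ : Y → Set Y := fun y => y.elim (Set.range fun n => some ⟨n, x (t n).1 (t n).2⟩)
    fun z => (fun z' => some ⟨z.1, z'⟩) '' ζ _ _ z.2
  have hξ : ∀ y, SizeLT κ (ξ y) := by
    rintro (_ | ⟨n, z⟩)
    · refine lt_of_le_of_lt (WithTop.coe_le_coe.mpr Cardinal.mk_range_le) ?_
      rwa [mk_shrink_Iio]
    · exact (hζ _ _ z).image _
  refine ⟨⟨proj ξ i none, proj_mem_level hξ i none⟩, .proj_mk hξ i none, fun j hj => ?_⟩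
  rw [comp_proj, elems_proj_succ]
  refine ⟨some ⟨equivShrink _ ⟨j, hj⟩, x _ _⟩, ⟨_, rfl⟩, ?_⟩
  rw [proj_morphism (ζ := ζ _ _) (fun z => (some ⟨equivShrink _ ⟨j, hj⟩, z⟩ : Y)) fun _ => rfl]
  -- The index is generalized because `X`, `ζ` and `x` depend on it.
  obtain ⟨n, hn⟩ : ∃ n, n = t (equivShrink _ ⟨j, hj⟩) := ⟨_, rfl⟩
  have e : n = ⟨j, hj⟩ := by simp [hn, t]
  rw [← hx j hj]
  change proj (ζ (t (equivShrink _ ⟨j, hj⟩)).1 (t (equivShrink _ ⟨j, hj⟩)).2) j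
    (x (t (equivShrink _ ⟨j, hj⟩)).1 (t (equivShrink _ ⟨j, hj⟩)).2) = _
  rw [← hn, e]

end Ghosts

/-! ### A ghost from a family of pruned sets of relations -/

section RelationTree

/-- The states of a system that codes a family of binary relations `A x`, for `x : J`, between
ordinals: ordinals, pairs of ordinals, a state for each relation, and a state for each set of
relations from a family. -/
inductive CodeState (T J : Type u) : Type u
  | ord (t : T)
  | pair (s t : T)
  | node (x : J)
  | root (t : T)

namespace CodeState

variable {T J : Type u}

/-- The system that codes the relations `A x`: the state of `x` has the pairs in the relation as
successors, and all the pairs with second component `i`. The bound `d` separates first components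
from second components. -/
def succs (r : T → Ordinal.{u}) (i d : Ordinal.{u}) (A : J → Ordinal.{u} → Ordinal.{u} → Prop)
    (F : Ordinal.{u} → Set J) : CodeState T J → Set (CodeState T J)
  | ord t => ord '' {s | r s < r t}
  | pair s t => {ord s, ord t}
  | node x => {y | ∃ s t, r s < d ∧ (d ≤ r t ∧ r t < i ∧ A x (r s) (r t) ∨ r t = i) ∧
      y = pair s t}
  | root t => node '' F (r t)

theorem mk_lt {κ : WithTop Cardinal.{u}} (hκ : InfiniteRegular κ)
    (hT : (Cardinal.mk T : WithTop Cardinal.{u}) < κ)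
    (hJ : (Cardinal.mk J : WithTop Cardinal.{u}) < κ) :
    (Cardinal.mk (CodeState T J) : WithTop Cardinal.{u}) < κ := by
  rcases hκ with rfl | ⟨c, rfl, hc⟩
  · exact WithTop.coe_lt_top _
  · have hc := hc.aleph0_le
    rw [WithTop.coe_lt_coe] at hT hJ ⊢
    let f : CodeState T J → T ⊕ (T × T) ⊕ J ⊕ T
      | ord t => .inl t
      | pair s t => .inr (.inl (s, t))
      | node x => .inr (.inr (.inl x))
      | root t => .inr (.inr (.inr t))
    have hf : Function.Injective f := by
      intro x y h
      cases x <;> cases y <;> simp_all [f]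
    refine (Cardinal.mk_le_of_injective hf).trans_lt ?_
    simp only [Cardinal.mk_sum, Cardinal.mk_prod, Cardinal.lift_id]
    exact Cardinal.add_lt_of_lt hc hT (Cardinal.add_lt_of_lt hc (Cardinal.mul_lt_of_lt hc hT hT)
      (Cardinal.add_lt_of_lt hc hJ hT))

variable {r : T → Ordinal.{u}} {i d : Ordinal.{u}}
  {A : J → Ordinal.{u} → Ordinal.{u} → Prop} {F : Ordinal.{u} → Set J}

local notation "p" => proj (succs r i d A F)

/-- The projection at `k` cannot separate ordinals that are at least `k`. -/
theorem proj_ord_eq (hr : ∀ o ≤ i, ∃ t, r t = o) (hri : ∀ t, r t ≤ i) (k : Ordinal.{u}) {s t : T}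
    (hs : k ≤ r s) (ht : k ≤ r t) : p k (ord s) = p k (ord t) := by
  induction k using SuccOrder.prelimitRecOn generalizing s t with
  | succ k _ ih =>
    have key : ∀ {s t : T}, succ k ≤ r s → succ k ≤ r t →
        p k '' succs r i d A F (ord s) ⊆ p k '' succs r i d A F (ord t) := by
      rintro s t hs ht _ ⟨_, ⟨s', hs', rfl⟩, rfl⟩
      rcases lt_or_ge (r s') k with h | h
      · exact ⟨_, ⟨s', h.trans (succ_le_iff.mp ht), rfl⟩, rfl⟩
      -- A successor of rank at least `k` is matched by the state of rank exactly `k`.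
      · obtain ⟨u, hu⟩ := hr k ((le_succ k).trans (hs.trans (hri s)))
        refine ⟨_, ⟨u, ?_, rfl⟩, ih hu.ge h⟩
        rw [Set.mem_ofPred, hu]
        exact succ_le_iff.mp ht
    rw [proj_succ_eq_iff]
    exact Set.Subset.antisymm (key hs ht) (key ht hs)
  | isSuccPrelimit k hk ih =>
    exact (proj_limit_eq_iff hk).mpr fun j hj => ih j hj (hj.le.trans hs) (hj.le.trans ht)

/-- The larger ordinal has `ord s` as a successor; a match for it below `s` would contradict the
claim at the smaller index `r s`. -/
theorem proj_ord_ne (k : Ordinal.{u}) {s t : T} (hs : r s < k) (hst : r s < r t) :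
    p k (ord s) ≠ p k (ord t) := by
  induction k using WellFoundedLT.induction generalizing s t with
  | ind k ih =>
    intro h
    have h' := proj_eq_of_le (succ_le_iff.mpr hs) h
    rw [proj_succ_eq_iff] at h'
    obtain ⟨_, ⟨u, hu, rfl⟩, e⟩ := h'.symm.subset ⟨ord s, ⟨s, hst, rfl⟩, rfl⟩
    exact ih _ hs hu hu e

theorem rank_eq_of_proj_ord_eq {k : Ordinal.{u}} {s t : T} (hs : r s < k)
    (h : p k (ord s) = p k (ord t)) : r t = r s := by
  rcases lt_trichotomy (r s) (r t) with h' | h' | h'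
  · exact absurd h (proj_ord_ne k hs h')
  · exact h'.symm
  · exact absurd h.symm (proj_ord_ne k (h'.trans hs) h')

theorem proj_pair_eq (hr : ∀ o ≤ i, ∃ t, r t = o) (hri : ∀ t, r t ≤ i) (k : Ordinal.{u})
    {s t t' : T} (ht : k ≤ r t) (ht' : k ≤ r t') : p k (pair s t) = p k (pair s t') := by
  induction k using SuccOrder.prelimitRecOn with
  | succ k _ _ =>
    rw [proj_succ_eq_iff]
    simp only [succs, Set.image_pair]
    rw [proj_ord_eq hr hri k ((le_succ k).trans ht) ((le_succ k).trans ht')]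
  | isSuccPrelimit k hk ih =>
    exact (proj_limit_eq_iff hk).mpr fun j hj => ih j hj (hj.le.trans ht) (hj.le.trans ht')

/-- The relations `R` and `S` agree below `j`. -/
def Agree (d j : Ordinal.{u}) (R S : Ordinal.{u} → Ordinal.{u} → Prop) : Prop :=
  ∀ g < d, ∀ b, d ≤ b → b < j → (R g b ↔ S g b)

theorem Agree.symm {j : Ordinal.{u}} {R S : Ordinal.{u} → Ordinal.{u} → Prop}
    (h : Agree d j R S) : Agree d j S R := fun g hg b hb hbj => (h g hg b hb hbj).symm

theorem Agree.trans {j : Ordinal.{u}} {Q R S : Ordinal.{u} → Ordinal.{u} → Prop}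
    (h : Agree d j Q R) (h' : Agree d j R S) : Agree d j Q S :=
  fun g hg b hb hbj => (h g hg b hb hbj).trans (h' g hg b hb hbj)

theorem Agree.mono {j k : Ordinal.{u}} {R S : Ordinal.{u} → Ordinal.{u} → Prop}
    (h : Agree d k R S) (hjk : j ≤ k) : Agree d j R S :=
  fun g hg b hb hbj => h g hg b hb (hbj.trans_le hjk)

/-- A pair whose second component is at least `k` looks at `k` like a pair ending in `i`, and every
node has all of those. Only the relation below `k` remains visible. -/
theorem proj_node_eq (hr : ∀ o ≤ i, ∃ t, r t = o) (hri : ∀ t, r t ≤ i) {k : Ordinal.{u}}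
    (hk : k ≤ i) {x y : J} (h : Agree d k (A x) (A y)) : p k (node x) = p k (node y) := by
  induction k using SuccOrder.prelimitRecOn generalizing x y with
  | succ k _ _ =>
    have key : ∀ {x y : J}, Agree d (succ k) (A x) (A y) →
        p k '' succs r i d A F (node x) ⊆ p k '' succs r i d A F (node y) := by
      rintro x y h _ ⟨_, ⟨s, t, hs, ht, rfl⟩, rfl⟩
      rcases lt_or_ge (r t) k with htk | htk
      · refine ⟨_, ⟨s, t, hs, ?_, rfl⟩, rfl⟩
        exact ht.imp_left fun ht => ⟨ht.1, ht.2.1,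
          (h _ hs _ ht.1 (htk.trans (lt_succ k))).mp ht.2.2⟩
      · obtain ⟨u, hu⟩ := hr i le_rfl
        refine ⟨_, ⟨s, u, hs, .inr hu, rfl⟩, proj_pair_eq hr hri k ?_ htk⟩
        exact hu.symm ▸ (le_succ k).trans hk
    rw [proj_succ_eq_iff]
    exact Set.Subset.antisymm (key h) (key h.symm)
  | isSuccPrelimit k hkl ih =>
    exact (proj_limit_eq_iff hkl).mpr fun j hj => ih j hj (hj.le.trans hk) (h.mono hj.le)

/-- The two extra levels are spent in descending from a node to a pair and from a pair to its
ordinals. -/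
theorem agree_of_proj_node_eq (hr : ∀ o ≤ i, ∃ t, r t = o) {m : Ordinal.{u}} (hm : d ≤ m)
    (hmi : m < i) {x y : J} (h : p (succ (succ m)) (node x) = p (succ (succ m)) (node y)) :
    Agree d m (A x) (A y) := by
  have key : ∀ {x y : J}, p (succ (succ m)) (node x) = p (succ (succ m)) (node y) →
      ∀ g < d, ∀ b, d ≤ b → b < m → A x g b → A y g b := by
    intro x y h g hg b hb hbm hA
    obtain ⟨s, rfl⟩ := hr g ((hg.trans_le hm).trans hmi).le
    obtain ⟨t, rfl⟩ := hr b (hbm.trans hmi).le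
    rw [proj_succ_eq_iff] at h
    obtain ⟨_, ⟨s', t', hs', ht', rfl⟩, e⟩ :=
      h.subset ⟨pair s t, ⟨s, t, hg, .inl ⟨hb, hbm.trans hmi, hA⟩, rfl⟩, rfl⟩
    rw [proj_succ_eq_iff] at e
    simp only [succs, Set.image_pair] at e
    have hdt' : d ≤ r t' := ht'.elim And.left fun e => e ▸ hm.trans hmi.le
    -- State pairs are unordered; the swapped match is impossible because first components are below
    -- `d` and second ones are not.
    rcases Set.pair_eq_pair_iff.mp e with ⟨e₁, e₂⟩ | ⟨e₁, e₂⟩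
    · rw [rank_eq_of_proj_ord_eq (hs'.trans_le hm) e₁]
      have ht := rank_eq_of_proj_ord_eq hbm e₂.symm
      rcases ht' with ht' | ht'
      · rw [← ht]
        exact ht'.2.2
      · exact absurd (ht'.symm.trans ht) (hbm.trans hmi).ne'
    · have := rank_eq_of_proj_ord_eq (hs'.trans_le hm) e₁
      exact absurd (this ▸ hs') hb.not_gt
  exact fun g hg b hb hbm => ⟨key h g hg b hb hbm, key h.symm g hg b hb hbm⟩

/-- This makes the projections of the roots a compatible family: restricting to level `k` and
extending again changes no relation below `k`. -/
theorem proj_root_eq (hr : ∀ o ≤ i, ∃ t, r t = o) (hri : ∀ t, r t ≤ i)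
    (hFdown : ∀ j k, j ≤ k → k < i → ∀ x ∈ F k, ∃ y ∈ F j, Agree d j (A x) (A y))
    (hFup : ∀ j k, j ≤ k → k < i → ∀ y ∈ F j, ∃ x ∈ F k, Agree d j (A y) (A x))
    (k : Ordinal.{u}) {s t : T} (hs : k ≤ r s) (ht : k ≤ r t) (hsi : r s < i) (hti : r t < i) :
    p k (root s) = p k (root t) := by
  induction k using SuccOrder.prelimitRecOn with
  | succ k _ _ =>
    have key : ∀ {s t : T}, succ k ≤ r s → succ k ≤ r t → r s < i → r t < i →
        p k '' succs r i d A F (root s) ⊆ p k '' succs r i d A F (root t) := by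
      rintro s t hs ht hsi hti _ ⟨_, ⟨x, hx, rfl⟩, rfl⟩
      obtain ⟨y, hy, hxy⟩ := hFdown k _ ((le_succ k).trans hs) hsi x hx
      obtain ⟨z, hz, hyz⟩ := hFup k _ ((le_succ k).trans ht) hti y hy
      exact ⟨_, ⟨z, hz, rfl⟩, proj_node_eq hr hri ((le_succ k).trans (hs.trans hsi.le))
        (hxy.trans hyz).symm⟩
    rw [proj_succ_eq_iff]
    exact Set.Subset.antisymm (key hs ht hsi hti) (key ht hs hti hsi)
  | isSuccPrelimit k hk ih =>
    exact (proj_limit_eq_iff hk).mpr fun j hj => ih j hj (hj.le.trans hs) (hj.le.trans ht)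

end CodeState

open CodeState

/-- A pruned tree of relations (the `j`-th level consists of the restrictions below `j` of the
`A x` with `x ∈ F j`) without branches yields a ghost. -/
theorem exists_isGhost {κ : WithTop Cardinal.{u}} (hκ : InfiniteRegular κ) {i : Ordinal.{u}}
    (hi : IsSuccPrelimit i) (hcard : (i.card : WithTop Cardinal.{u}) < κ) {d : Ordinal.{u}}
    (hd : d < i) {J : Type u} (hJ : (Cardinal.mk J : WithTop Cardinal.{u}) < κ)
    (A : J → Ordinal.{u} → Ordinal.{u} → Prop) (F : Ordinal.{u} → Set J)
    (hF : ∀ j < i, (F j).Nonempty)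
    (hFdown : ∀ j k, j ≤ k → k < i → ∀ x ∈ F k, ∃ y ∈ F j, Agree d j (A x) (A y))
    (hFup : ∀ j k, j ≤ k → k < i → ∀ y ∈ F j, ∃ x ∈ F k, Agree d j (A y) (A x))
    (hbranch : ∀ B, ¬ ∀ j < i, ∃ x ∈ F j, Agree d j B (A x)) :
    ∃ a : level κ i, IsGhost hi a := by
  let T := Shrink.{u} (Set.Iio (succ i))
  let r : T → Ordinal.{u} := fun t => ((equivShrink _).symm t).1
  have hr : ∀ o ≤ i, ∃ t, r t = o := fun o ho =>
    ⟨equivShrink _ ⟨o, lt_succ_iff.mpr ho⟩, by simp [r]⟩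
  have hri : ∀ t, r t ≤ i := fun t => lt_succ_iff.mp ((equivShrink _).symm t).2
  have hT : (Cardinal.mk T : WithTop Cardinal.{u}) < κ := by
    rw [mk_shrink_Iio, succ_eq_add_one, Ordinal.card_add_one]
    rcases hκ with rfl | ⟨c, rfl, hc⟩
    · exact WithTop.coe_lt_top _
    · exact WithTop.coe_lt_coe.mpr (Cardinal.add_lt_of_lt hc.aleph0_le (WithTop.coe_lt_coe.mp hcard)
        (Cardinal.one_lt_aleph0.trans_le hc.aleph0_le))
  let ζ := succs r i d A F
  have hζ : ∀ y, SizeLT κ (ζ y) := fun y => sizeLT_of_mk_lt (CodeState.mk_lt hκ hT hJ) _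
  choose t ht using hr
  have hroot : ∀ j k (hjk : j ≤ k) (hk : k < i),
      proj ζ j (root (t k hk.le)) = proj ζ j (root (t j (hjk.trans hk.le))) := fun j k hjk hk =>
    proj_root_eq (fun o ho => ⟨t o ho, ht o ho⟩) hri hFdown hFup j (by rwa [ht]) (by rw [ht])
      (by rwa [ht]) (by rw [ht]; exact hjk.trans_lt hk)
  let a : Pre i := family hi fun j hj => proj ζ j (root (t j hj.le))
  have ha : a ∈ level κ i := (mem_level_limit hi).mpr ⟨fun j hj => by
      rw [comp_family]
      exact proj_mem_level hζ _ _, fun j hj k hk => by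
      rw [comp_family, comp_family, conn_proj, hroot k j hk hj]⟩
  refine ⟨⟨a, ha⟩, fun j hj => ?_, fun h => ?_, fun b hb => ?_⟩
  · rw [comp_family]
    exact .proj_mk hζ _ _
  · have h1 : succ 0 < i := hi.succ_lt (bot_le.trans_lt hd)
    have e : elems (comp hi a (succ 0) h1) = ∅ := by
      rw [show a = zeroAt i from h, comp_zeroAt, elems_zeroAt_succ]
    rw [comp_family, elems_proj_succ, Set.image_eq_empty] at e
    obtain ⟨x, hx⟩ := hF _ h1
    rw [← ht _ h1.le] at hx
    exact e.subset ⟨x, hx, rfl⟩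
  · have hx : ∀ j, j < i → ∃ x, x ∈ F (succ j) ∧
        ∀ hj : j < i, proj ζ j (node x) = comp hi b.1 j hj := fun j hj => by
      have := hb j hj
      rw [comp_family, elems_proj_succ] at this
      obtain ⟨_, ⟨x, hx, rfl⟩, e⟩ := this
      rw [ht] at hx
      exact ⟨x, hx, fun _ => e⟩
    have : Nonempty J := ⟨(hF d hd).some⟩
    choose! x hxF hxb using hx
    have hagree : ∀ m j, d ≤ m → succ (succ m) ≤ j → j < i →
        Agree d m (A (x j)) (A (x (succ (succ m)))) := fun m j hm hmj hj => by
      have hm' := hmj.trans_lt hj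
      refine agree_of_proj_node_eq (r := r) (F := F) (fun o ho => ⟨t o ho, ht o ho⟩) hm
        ((lt_succ m).trans_le ((le_succ _).trans hm'.le)) ?_
      rw [hxb _ hm' hm', ← ((mem_level_limit hi).mp b.2).2 j hj _ hmj, ← hxb _ hj hj, conn_proj]
    -- A successor of `a` yields nodes `x j` with coherent projections. Those at indices from `b +
    -- 3` on agree below `b + 1`, hence at `b`, so `x (b + 3)` may decide `B` at `b`.
    refine hbranch (fun g b => A (x (succ (succ (succ b)))) g b) fun j hj => ?_
    rcases lt_or_ge j d with hjd | hjd
    · obtain ⟨y, hy⟩ := hF j hj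
      exact ⟨y, hy, fun g _ b hb hbj => absurd (hb.trans_lt hbj) hjd.not_gt⟩
    · have hj2 := hi.succ_lt (hi.succ_lt hj)
      obtain ⟨y, hy, hxy⟩ := hFdown j _ (((le_succ _).trans (le_succ _)).trans (le_succ _))
        (hi.succ_lt hj2) _ (hxF _ hj2)
      refine ⟨y, hy, Agree.trans (fun g hg b hb hbj => ?_) hxy⟩
      exact (hagree (succ b) _ (hb.trans (le_succ b))
        (succ_le_succ (succ_le_succ (succ_le_iff.mpr hbj))) hj2 g hg b hb (lt_succ b)).symm

end RelationTree

/-! ### Branchless trees: small cofinality and failure of the tree property -/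

section ExistenceOfGhosts

open CodeState

variable {κ : WithTop Cardinal.{u}} {i : Ordinal.{u}}

/-- The relation that codes a finite set of ordinals: `b` is related to the elements of the code of
the least element of the set above `b`. -/
def ladderRel {ι : Type u} (f : ι → Ordinal.{u}) (e : ι → Set Ordinal.{u}) (S : Finset ι)
    (g b : Ordinal.{u}) : Prop :=
  ∃ n ∈ S, b ≤ f n ∧ (∀ m ∈ S, b ≤ f m → f n ≤ f m) ∧ g ∈ e n

theorem exists_ladderRel_iff {ι : Type u} {f : ι → Ordinal.{u}} (hf : Function.Injective f)
    (e : ι → Set Ordinal.{u}) {S : Finset ι} {b : Ordinal.{u}} (h : ∃ n ∈ S, b ≤ f n) :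
    ∃ n ∈ S, b ≤ f n ∧ ∀ g, ladderRel f e S g b ↔ g ∈ e n := by
  classical
  obtain ⟨n, hn, hmin⟩ := (S.filter fun n => b ≤ f n).exists_min_image f
    (by simpa [Finset.Nonempty] using h)
  simp only [Finset.mem_filter, and_imp] at hn hmin
  refine ⟨n, hn.1, hn.2, fun g => ⟨?_, fun hg => ⟨n, hn.1, hn.2, hmin, hg⟩⟩⟩
  rintro ⟨m, hm, hbm, hmin', hg⟩
  rwa [hf ((hmin m hm hbm).antisymm (hmin' n hn.1 hn.2))]

/-- A branch `B` determines for each `b` an index `N b` with `f (N b) ≥ b`, which lies in every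
finite set that represents `B` beyond `b`. Iterating `N` gives a strictly increasing sequence of
ordinals; it is bounded below `i`, so one finite set would contain infinitely many indices. -/
theorem exists_isGhost_of_ladder (hκ : InfiniteRegular κ) (hi : IsSuccPrelimit i)
    (hcard : (i.card : WithTop Cardinal.{u}) < κ) (hω : ¬ IsOmegaCofinal i) {d : Ordinal.{u}}
    (hd : d < i) {ι : Type u} (hι : (Cardinal.mk ι : WithTop Cardinal.{u}) < κ)
    (f : ι → Ordinal.{u}) (hf : Function.Injective f) (hfi : ∀ n, f n < i)
    (hcof : ∀ k < i, ∃ n, k ≤ f n) (e : ι → Set Ordinal.{u})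
    (he : ∀ n m, (∀ g < d, g ∈ e n ↔ g ∈ e m) → n = m) :
    ∃ a : level κ i, IsGhost hi a := by
  classical
  have hJ : (Cardinal.mk (Finset ι) : WithTop Cardinal.{u}) < κ := by
    rcases finite_or_infinite ι with h | h
    · exact (WithTop.coe_le_coe.mpr Cardinal.mk_univ.ge).trans_lt
        (hκ.sizeLT_of_finite (Set.finite_univ (α := Finset ι)))
    · rwa [Cardinal.mk_finset_of_infinite]
  refine exists_isGhost hκ hi hcard hd hJ (ladderRel f e) (fun j => {S | ∃ n ∈ S, j ≤ f n})
    (fun j hj => ?_) (fun j k hjk hk S hS => ?_) (fun j k hjk hk S hS => ?_) (fun B hB => ?_)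
  · obtain ⟨n, hn⟩ := hcof j hj
    exact ⟨{n}, n, Finset.mem_singleton_self n, hn⟩
  · obtain ⟨n, hn, hkn⟩ := hS
    exact ⟨S, ⟨n, hn, hjk.trans hkn⟩, fun _ _ _ _ _ => Iff.rfl⟩
  · by_cases h : ∃ n ∈ S, k ≤ f n
    · exact ⟨S, h, fun _ _ _ _ _ => Iff.rfl⟩
    push Not at h
    -- The added point lies above all of `S`, and `S` already reaches `j`, so least elements above
    -- any `b < j` are unchanged.
    obtain ⟨m, hm⟩ := hcof k hk
    refine ⟨insert m S, ⟨m, Finset.mem_insert_self m S, hm⟩, fun g _ b _ hbj => ⟨?_, ?_⟩⟩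
    · rintro ⟨n, hn, hbn, hmin, hg⟩
      refine ⟨n, Finset.mem_insert_of_mem hn, hbn, fun n' hn' hbn' => ?_, hg⟩
      rcases Finset.mem_insert.mp hn' with rfl | hn'
      · exact (h n hn).le.trans hm
      · exact hmin n' hn' hbn'
    · rintro ⟨n, hn, hbn, hmin, hg⟩
      rcases Finset.mem_insert.mp hn with rfl | hn
      · obtain ⟨n', hn', hjn'⟩ := hS
        exact absurd ((hmin n' (Finset.mem_insert_of_mem hn') (hbj.le.trans hjn')).trans_lt
          (h n' hn')) hm.not_gt
      · exact ⟨n, hn, hbn, fun n' hn' => hmin n' (Finset.mem_insert_of_mem hn'), hg⟩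
  · have hN : ∀ b, d ≤ b → b < i → ∃ n, b ≤ f n ∧ ∀ g < d, B g b ↔ g ∈ e n := fun b hb hbi => by
      obtain ⟨S, ⟨m, hm, hbm⟩, hS⟩ := hB (succ b) (hi.succ_lt hbi)
      obtain ⟨n, -, hbn, hn⟩ := exists_ladderRel_iff hf e ⟨m, hm, (le_succ b).trans hbm⟩
      exact ⟨n, hbn, fun g hg => (hS g hg b hb (lt_succ b)).trans (hn g)⟩
    have : Nonempty ι := ⟨(hcof d hd).choose⟩
    choose! N hbN hBN using hN
    have hNS : ∀ j (S : Finset ι), (∃ n ∈ S, j ≤ f n) → Agree d j B (ladderRel f e S) →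
        ∀ b, d ≤ b → b < j → b < i → N b ∈ S := by
      rintro j S ⟨m, hm, hjm⟩ hS b hb hbj hbi
      obtain ⟨n, hnS, -, hn⟩ := exists_ladderRel_iff hf e ⟨m, hm, hbj.le.trans hjm⟩
      rwa [he (N b) n fun g hg => by
        rw [← hBN b hb hbi g hg, hS g hg b hb hbj, hn]]
    let v : ℕ → ι := fun n => Nat.rec (N d) (fun _ m => N (succ (f m))) n
    have hvd : ∀ n, d ≤ f (v n) := by
      intro n
      induction n with
      | zero => exact hbN d le_rfl hd
      | succ n ih =>
        exact (ih.trans (le_succ _)).trans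
          (hbN (succ (f (v n))) (ih.trans (le_succ _)) (hi.succ_lt (hfi _)))
    have hv : StrictMono fun n => f (v n) := strictMono_nat_of_lt_succ fun n =>
      succ_le_iff.mp (hbN (succ (f (v n))) ((hvd n).trans (le_succ _)) (hi.succ_lt (hfi _)))
    refine hω ⟨_, hv, ?_, fun j hj => ?_⟩
    · rintro _ ⟨n, rfl⟩
      exact (hfi _).le
    by_contra! hji
    -- The arguments of `N` go up to `j + 1`, so `B` must be represented below `j + 2`.
    have hj2 := hi.succ_lt (hi.succ_lt hji)
    obtain ⟨S, hS, hBS⟩ := hB _ hj2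
    have hle : ∀ n, f (v n) ≤ j := fun n => hj ⟨n, rfl⟩
    have hvS : ∀ n, v n ∈ S := by
      intro n
      cases n with
      | zero =>
        exact hNS _ S hS hBS d le_rfl
          ((((hvd 0).trans (hle 0)).trans_lt (lt_succ j)).trans (lt_succ _)) hd
      | succ n =>
        exact hNS _ S hS hBS _ ((hvd n).trans (le_succ _))
          ((succ_le_succ (hle n)).trans_lt (lt_succ _)) (hi.succ_lt (hfi _))
    have hinj : Function.Injective v := fun n m h => hv.injective (congrArg f h)
    exact Set.infinite_range_of_injective hinj
      (S.finite_toSet.subset (Set.range_subset_iff.mpr hvS))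

/-- The cardinal bound lets the points of a cofinal set of least size be labelled by distinct
subsets of `d`. -/
theorem exists_isGhost_of_cof_le (hκ : InfiniteRegular κ) (hi : IsSuccPrelimit i)
    (hcard : (i.card : WithTop Cardinal.{u}) < κ) (hω : ¬ IsOmegaCofinal i) {d : Ordinal.{u}}
    (hd : d < i) (h : i.cof ≤ 2 ^ d.card) : ∃ a : level κ i, IsGhost hi a := by
  obtain ⟨s, hs, hsc⟩ := Order.exists_cof_eq i.ToType
  rw [Ordinal.cof_toType] at hsc
  have hle : Cardinal.mk s ≤ Cardinal.mk (Set (Shrink.{u} (Set.Iio d))) := by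
    rwa [hsc, Cardinal.mk_set, mk_shrink_Iio]
  obtain ⟨φ⟩ := hle
  refine exists_isGhost_of_ladder hκ hi hcard hω hd (ι := s) ?_
    (fun n => Ordinal.typein (α := i.ToType) (· < ·) n.1) ?_ ?_ ?_
    (fun n => {g | ∃ hg : g < d, equivShrink _ ⟨g, hg⟩ ∈ φ n}) ?_
  · rw [hsc]
    exact (WithTop.coe_le_coe.mpr (Ordinal.cof_le_card i)).trans_lt hcard
  · exact fun n m hnm => Subtype.ext (Ordinal.typein_injective _ hnm)
  · exact fun n => Ordinal.typein_lt_self n.1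
  · intro k hk
    obtain ⟨n, hn, hkn⟩ := hs (Ordinal.enum (α := i.ToType) (· < ·) ⟨k, by simpa using hk⟩)
    have h := (Ordinal.typein_le_typein (α := i.ToType) (· < ·)).mpr (not_lt.mpr hkn)
    exact ⟨⟨n, hn⟩, (Ordinal.typein_enum (α := i.ToType) (· < ·) _).ge.trans h⟩
  · intro n m hnm
    apply φ.injective
    ext g
    obtain ⟨⟨g, hg⟩, rfl⟩ := (equivShrink _).surjective g
    have hg' : g < d := hg
    simpa [hg'] using hnm g hg

/-- The nodes of a tree of height `l` with `l` nodes can be labelled injectively by ordinals below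
`l` above their heights. -/
theorem exists_labelling {l : Cardinal.{u}} (hl : Cardinal.aleph0 ≤ l) {J : Type u}
    (hJ : Cardinal.mk J ≤ l) (ht : J → Ordinal.{u}) (hht : ∀ t, ht t < l.ord) :
    ∃ c : J → Ordinal.{u}, Function.Injective c ∧ (∀ t, ht t < c t) ∧ ∀ t, c t < l.ord := by
  let K := Shrink.{u} (Set.Iio l.ord)
  have hK : Cardinal.mk K = l := by rw [mk_shrink_Iio, Cardinal.card_ord]
  have hle : Cardinal.mk (J × K) ≤ Cardinal.mk K := by
    rw [Cardinal.mk_prod, Cardinal.lift_id, Cardinal.lift_id, hK]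
    exact (mul_le_mul_left hJ l).trans_eq (Cardinal.mul_eq_self hl)
  obtain ⟨φ⟩ := hle
  let r : K → Ordinal.{u} := fun t => ((equivShrink _).symm t).1
  have hr : Function.Injective r := Subtype.val_injective.comp (equivShrink _).symm.injective
  -- Each row `φ (t, ·)` takes `l` distinct values, too many to lie at or below `ht t`.
  have hc : ∀ t, ∃ s, ht t < r (φ (t, s)) := by
    intro t
    by_contra! h
    let ψ : K → Shrink.{u} (Set.Iio (succ (ht t))) := fun s =>
      equivShrink _ ⟨r (φ (t, s)), lt_succ_iff.mpr (h s)⟩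
    have hψ : Function.Injective ψ := fun s s' e => by
      have := congrArg Subtype.val ((equivShrink _).injective e)
      exact (Prod.ext_iff.mp (φ.injective (hr this))).2
    have hlt := Cardinal.mk_le_of_injective hψ
    rw [hK, mk_shrink_Iio] at hlt
    exact hlt.not_gt (Cardinal.lt_ord.mp ((Cardinal.isSuccLimit_ord hl).succ_lt (hht t)))
  choose s hs using hc
  refine ⟨fun t => r (φ (t, s t)), fun t t' e => ?_, hs, fun t =>
    ((equivShrink _).symm (φ (t, s t))).2⟩
  exact (Prod.ext_iff.mp (φ.injective (hr e))).1

/-- A node is coded by the set of labels of the nodes below it. Labels exceed heights, so its labels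
below a height `h` come from nodes below `h`; regularity bounds the labels of each level, so a
branch of the coded tree recovers a full branch of `D`. -/
theorem exists_isGhost_of_tree (hκ : InfiniteRegular κ) {l : Cardinal.{u}} (hl : l.IsRegular)
    (hi : IsSuccPrelimit l.ord) (hcard : (l : WithTop Cardinal.{u}) < κ)
    (D : InverseChain.{u} (Set.Iio l.ord)) (hD : D.IsTidy) (hsize : ∀ k, Cardinal.mk (D.obj k) < l)
    (hbranch : ∀ x, ¬ D.IsFullBranch x) : ∃ a : level κ l.ord, IsGhost hi a := by
  let K := Shrink.{u} (Set.Iio l.ord)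
  have hK : Cardinal.mk K = l := by rw [mk_shrink_Iio, Cardinal.card_ord]
  let r : K → Set.Iio l.ord := (equivShrink _).symm
  have hr : Function.Surjective r := (equivShrink _).symm.surjective
  let J := Σ n : K, D.obj (r n)
  let below : J → J → Prop := fun s t => ∃ h : r s.1 ≤ r t.1, D.map h t.2 = s.2
  have below_trans : ∀ {s t u : J}, below s t → below t u → below s u := by
    rintro s t u ⟨h, e⟩ ⟨h', e'⟩
    exact ⟨h.trans h', by rw [← D.map_map h h', e', e]⟩
  have below_of_le : ∀ {s t u : J}, below s u → below t u → r s.1 ≤ r t.1 → below s t := by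
    rintro s t u ⟨h, e⟩ ⟨h', e'⟩ hle
    exact ⟨hle, by rw [← e', D.map_map, e]⟩
  have hJ : Cardinal.mk J ≤ l := by
    rw [Cardinal.mk_sigma]
    refine (Cardinal.sum_le_mk_mul_iSup _).trans ?_
    rw [hK]
    refine (mul_le_mul_right ?_ l).trans_eq (Cardinal.mul_eq_self hl.aleph0_le)
    exact ciSup_le' fun n => (hsize _).le
  obtain ⟨c, hcinj, hltc, hcl⟩ := exists_labelling hl.aleph0_le hJ (fun t => (r t.1).1)
    fun t => (r t.1).2
  -- First components carry no information, so `d = 1` suffices; labels, being above heights, are at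
  -- least `1`.
  let A : J → Ordinal.{u} → Ordinal.{u} → Prop := fun t _ b => ∃ s, below s t ∧ c s = b
  have hagree : ∀ {s t : J}, below s t → Agree 1 (r s.1).1 (A t) (A s) := by
    intro s t hst g _ b _ hb
    refine ⟨?_, ?_⟩
    · rintro ⟨u, hu, rfl⟩
      exact ⟨u, below_of_le hu hst ((hltc u).trans hb).le, rfl⟩
    · rintro ⟨u, hu, rfl⟩
      exact ⟨u, below_trans hu hst, rfl⟩
  refine exists_isGhost hκ hi (by rwa [Cardinal.card_ord]) (d := 1)
    (by simpa using hi.succ_lt hl.ord_pos) ((WithTop.coe_le_coe.mpr hJ).trans_lt hcard) A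
    (fun j => {t | (r t.1).1 = j}) (fun j hj => ?_) (fun j k hjk hk t ht => ?_)
    (fun j k hjk hk s hs => ?_) (fun B hB => ?_)
  · obtain ⟨o, ho, ⟨x⟩⟩ := hD.root
    obtain ⟨n, hn⟩ := hr ⟨j, hj⟩
    obtain ⟨y, -⟩ := hD.surjective o (r n) (ho _) x
    exact ⟨⟨n, y⟩, congrArg Subtype.val hn⟩
  · obtain ⟨m, hm⟩ := hr ⟨j, hjk.trans_lt hk⟩
    obtain rfl : (r m).1 = j := congrArg Subtype.val hm
    obtain rfl : (r t.1).1 = k := ht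
    exact ⟨⟨m, D.map hjk t.2⟩, rfl, hagree (s := ⟨m, D.map hjk t.2⟩) ⟨hjk, rfl⟩⟩
  · obtain ⟨m, hm⟩ := hr ⟨k, hk⟩
    obtain rfl : (r m).1 = k := congrArg Subtype.val hm
    obtain rfl : (r s.1).1 = j := hs
    obtain ⟨y, hy⟩ := hD.surjective _ _ hjk s.2
    exact ⟨⟨m, y⟩, rfl, (hagree (t := ⟨m, y⟩) ⟨hjk, hy⟩).symm⟩
  · have hbound : ∀ k : Set.Iio l.ord,
        ∃ j < l.ord, k.1 ≤ j ∧ ∀ s : J, r s.1 = k → c s < j := by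
      intro k
      obtain ⟨n, rfl⟩ := hr k
      have hlt : ⨆ x : D.obj (r n), c ⟨n, x⟩ < l.ord :=
        Ordinal.iSup_lt_of_lt_cof (by rw [hl.cof_ord]; exact hsize _) fun x => hcl _
      refine ⟨succ (max (r n).1 (⨆ x : D.obj (r n), c ⟨n, x⟩)), hi.succ_lt (max_lt (r n).2 hlt),
        (le_max_left _ _).trans (le_succ _), ?_⟩
      rintro ⟨m, x⟩ hm
      obtain rfl := (equivShrink _).symm.injective hm
      exact lt_succ_of_le
        ((Ordinal.le_iSup (fun x : D.obj (r m) => c ⟨m, x⟩) x).trans (le_max_right _ _))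
    choose j hjl hkj hcj using hbound
    choose t ht htB using hB
    have hrt : ∀ {k m} (_ : j k ≤ m) (hm : m < l.ord), k ≤ r (t m hm).1 := fun {k m} hkm hm =>
      Subtype.coe_le_coe.mp (((hkj k).trans hkm).trans_eq (Eq.symm (ht m hm)))
    -- Past `j k` all labels of level `k` are decided by `B`, so the node at height `k` under `t m`
    -- no longer changes with `m`.
    have hx : ∀ {k m} (hkm : j k ≤ m) (hm : m < l.ord),
        D.map (hrt hkm hm) (t m hm).2 = D.map (hrt le_rfl (hjl k)) (t (j k) (hjl k)).2 := by
      intro k m hkm hm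
      obtain ⟨n, rfl⟩ := hr k
      let u : J := ⟨n, D.map (hrt le_rfl (hjl (r n))) (t (j (r n)) (hjl (r n))).2⟩
      have h1 : 1 ≤ c u := Order.one_le_iff_pos.mpr (bot_le.trans_lt (hltc u))
      have hB : B 0 (c u) := (htB _ (hjl _) 0 zero_lt_one _ h1 (hcj _ u rfl)).mpr
        ⟨u, ⟨hrt le_rfl (hjl _), rfl⟩, rfl⟩
      obtain ⟨s, ⟨hs, e⟩, hcs⟩ :=
        (htB m hm 0 zero_lt_one _ h1 ((hcj _ u rfl).trans_le hkm)).mp hB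
      obtain rfl := hcinj hcs
      exact e
    refine hbranch (fun k => D.map (hrt le_rfl (hjl k)) (t (j k) (hjl k)).2) fun k m h => ?_
    have hlt : max (j k) (j m) < l.ord := max_lt (hjl k) (hjl m)
    beta_reduce
    rw [← hx (le_max_left _ _) hlt, ← hx (le_max_right _ _) hlt, D.map_map]

/-- If the limit ordinal `i < κ` is neither `0` nor `ω`-cofinal nor weakly compact, then there is a
ghost at `i`. -/
theorem exists_isGhost_of_not_isWeaklyCompact (hκ : InfiniteRegular κ) (hi : IsSuccPrelimit i)
    (hcard : (i.card : WithTop Cardinal.{u}) < κ) (h0 : i ≠ 0) (hω : ¬ IsOmegaCofinal i)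
    (hwc : ¬ IsWeaklyCompact i) : ∃ a : level κ i, IsGhost hi a := by
  by_cases h : ∃ d < i, i.cof ≤ 2 ^ d.card
  · obtain ⟨d, hd, h⟩ := h
    exact exists_isGhost_of_cof_le hκ hi hcard hω hd h
  push Not at h
  have hl : i.cof.IsRegular := Cardinal.isRegular_cof ⟨by simpa using h0, hi⟩
  obtain ⟨l, hil⟩ : ∃ l, l = i.cof := ⟨_, rfl⟩
  -- Were the cofinality `l` below `i`, taking `d = l` would give `2 ^ l < l`.
  have hi' : i = l.ord := by
    refine le_antisymm ?_ (hil ▸ Ordinal.ord_cof_le i)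
    by_contra! hlt
    have := h _ hlt
    rw [Cardinal.card_ord, ← hil] at this
    exact this.not_gt (Cardinal.cantor l)
  rw [← hil] at hl h
  clear hil
  subst hi'
  have htree : ¬ TreeProperty l := fun ht => hwc ⟨l, rfl, hl, fun A hA => by
    have := h _ (Cardinal.ord_lt_ord.mpr hA)
    rwa [Cardinal.card_ord, ← Cardinal.mk_set] at this, ht⟩
  unfold TreeProperty at htree
  push Not at htree
  obtain ⟨D, hD, hsize, hbranch⟩ := htree
  exact exists_isGhost_of_tree hκ hl hi (by rwa [Cardinal.card_ord] at hcard) D hD hsize hbranch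

end ExistenceOfGhosts

end FinalChain

theorem proposition7p21 (κ : WithTop Cardinal.{u}) (hκ : FinalChain.InfiniteRegular κ)
    (i : Ordinal.{u}) (hi : Order.IsSuccPrelimit i) :
    (FinalChain.IsSubsystem (FinalChain.Trans hi)
        {a : FinalChain.level κ i | FinalChain.IsCoalgebraic κ a.1} ↔
      i = 0 ∨ FinalChain.IsOmegaCofinal i ∨ FinalChain.IsWeaklyCompact i ∨
        FinalChain.LEOrd κ i) ∧
    (¬ (i = 0 ∨ FinalChain.IsOmegaCofinal i ∨ FinalChain.IsWeaklyCompact i ∨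
        FinalChain.LEOrd κ i) →
      (∃ a : FinalChain.level κ i, FinalChain.IsGhost hi a) ∧
      ∀ a : FinalChain.level κ i, FinalChain.IsGhost hi a →
        ¬ FinalChain.IsCoalgebraic κ a.1 ∧
        ∃ c : FinalChain.level κ i, FinalChain.IsCoalgebraic κ c.1 ∧
          FinalChain.Trans hi c a) := by
  have ghosts : ¬ (i = 0 ∨ FinalChain.IsOmegaCofinal i ∨ FinalChain.IsWeaklyCompact i ∨
        FinalChain.LEOrd κ i) →
      (∃ a : FinalChain.level κ i, FinalChain.IsGhost hi a) ∧
      ∀ a : FinalChain.level κ i, FinalChain.IsGhost hi a →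
        ¬ FinalChain.IsCoalgebraic κ a.1 ∧
        ∃ c : FinalChain.level κ i, FinalChain.IsCoalgebraic κ c.1 ∧
          FinalChain.Trans hi c a := by
    intro h
    push Not at h
    obtain ⟨h0, hω, hwc, hle⟩ := h
    have hcard := FinalChain.card_lt_of_not_leOrd hκ hle
    exact ⟨FinalChain.exists_isGhost_of_not_isWeaklyCompact hκ hi hcard h0 hω hwc, fun a ha =>
      ⟨ha.not_isCoalgebraic, FinalChain.exists_isCoalgebraic_trans hcard a ha.1⟩⟩
  refine ⟨⟨fun hsub => ?_, fun h => ?_⟩, ghosts⟩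
  · by_contra h
    obtain ⟨⟨a, ha⟩, hghost⟩ := ghosts h
    obtain ⟨hna, c, hc, hca⟩ := hghost a ha
    exact hna (hsub c hc a hca)
  · intro a ha b hab
    -- The size of `i` is settled first: an `ω`-cofinal or weakly compact `i` may be at least `κ`,
    -- where the chosen successor sets need not be `<κ`-sized.
    by_cases hle : FinalChain.LEOrd κ i
    · exact FinalChain.isCoalgebraic_of_trans_of_leOrd hκ hi hle hab ha
    refine FinalChain.isCoalgebraic_of_isDense hκ (FinalChain.card_lt_of_not_leOrd hκ hle)
      (fun b hb => ?_) b (hab.isCoalgebraic_comp fun j hj => FinalChain.IsCoalgebraic.comp ha j hj)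
    rcases h with rfl | hω | hwc | hle'
    · exact fun j hj => absurd hj not_lt_zero
    · exact FinalChain.isDense_of_isOmegaCofinal hω b hb
    · exact FinalChain.isDense_of_isWeaklyCompact hwc b hb
    · exact absurd hle' hle
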